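/- Let $M$ be a first-order structure in a language $\mathcal L$, let $G$ be a group $\emptyset$-definable in $M$, let $\mathfrak C\succ M$ be a monster model ($\kappa$-saturated and strongly $\kappa$-homogeneous for an uncountable strong limit cardinal $\kappa>|M|+|\mathcal L|$; "bounded" means of cardinality $<\kappa$), and let $G^*$ be the interpretation of $G$ in $\mathfrak C$. Let $\Delta$ be a set of $\mathcal L$-formulas $\delta(x;y,z,\bar t)$ of the form $\psi(y\cdot x\cdot z;\bar t)$ that contains $G(y\cdot x\cdot z)$, where $G(x)$ defines $G$. A subset of $G$ (of $G^*$) is $\Delta$-definable over $M$ if it is a Boolean combination of sets defined by instances of formulas in $\Delta$ with parameters from $M$ (those for $y,z$ being in $G$); an intersection of such subsets of $G^*$ is called $\Delta$-type-definable over $M$. A $\Delta$-definable $G$-ambit $(X,x)$ is a compact Hausdorff space $X$ with an action of $G$ by homeomorphisms and a point $x$ with dense orbit such that for every $y\in X$ and all disjoint closed $C_1,C_2\subseteq X$ the sets $\{g\in G: gy\in C_1\}$ and $\{g\in G: gy\in C_2\}$ are separated by a $\Delta$-definable subset of $G$. Let $(\mathcal U,x_0)$ be the universal $\Delta$-definable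 $G$-ambit, let $f^*:G^*\to\mathcal U$ be the unique extension of $g\mapsto gx_0$ such that preimages of closed sets are $\Delta$-type-definable over $M$, and let $E'_\Delta$ be the equivalence relation $f^*(a)=f^*(b)$ on $G^*$. The quotient $G^*/E'_\Delta$ (identified with $\mathcal U$) carries the logic topology (a set is closed iff its preimage in $G^*$ is type-definable over $M$), the action $g(a/E'_\Delta)=(ga)/E'_\Delta$ of $G$, and the semigroup operation $p*q=\lim_{g\to p}gq$, where $g\to p$ means that $g/E'_\Delta$ tends to $p$ with $g$ ranging over $G$. Let $\mathcal M$ be a minimal left ideal of $G^*/E'_\Delta$ and $u\in\mathcal M$ an idempotent, so that $u\mathcal M$ is a group under $*$. For $A\subseteq u\mathcal M$ let $\operatorname{cl}_\tau(A)$ be the set of all $x\in u\mathcal M$ for which there are nets $(x_i)$ in $A$ and $(g_i)$ in $G$ with $\lim_i g_i/E'_\Delta=u$ and $\lim_i g_ix_i=x$. This is a closure operator, which defines the $\tau$-topology on $u\mathcal M$. Let $H(u\mathcal M)$ be the intersection of the sets $\operatorname{cl}_\tau(V)$ over all $\tau$-neighbourhoods $V$ of $u$; it is a normal subgroup of $u\mathcal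 M$. Let ${G^*}^{00}_{\Delta,M}$ be the smallest $\Delta$-type-definable over $M$ subgroup of $G^*$ of bounded index; it is normal, and $G^*/{G^*}^{00}_{\Delta,M}$ is equipped with the logic topology. Let $\theta:u\mathcal M\to G^*/{G^*}^{00}_{\Delta,M}$ be the restriction to $u\mathcal M$ of the well-defined map $a/E'_\Delta\mapsto a/{G^*}^{00}_{\Delta,M}$; it is a group epimorphism. Equip $u\mathcal M$ with the $\tau$-topology and $u\mathcal M/H(u\mathcal M)$ with the induced quotient topology. Then: 1. $\theta$ is continuous; 2. $H(u\mathcal M)\le\ker(\theta)$; 3. the formula $p*H(u\mathcal M)\mapsto\theta(p)$ yields a well-defined continuous epimorphism $\bar\theta:u\mathcal M/H(u\mathcal M)\to G^*/{G^*}^{00}_{\Delta,M}$. In particular, there are continuous epimorphisms $$u\mathcal M\twoheadrightarrow u\mathcal M/H(u\mathcal M)\overset{\bar\theta}{\twoheadrightarrow}G^*/{G^*}^{00}_{\Delta,M}.$$ -/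

import Mathlib

open FirstOrder Topology Filter Cardinal

universe u v w' w

namespace DeltaFlow

/-! ### Monster models -/

/-- `C` is `κ`-saturated: every finitely satisfiable set of formulas in finitely many variables
with fewer than `κ` parameters from `C` is realized in `C`. -/
def IsSaturated (L : FirstOrder.Language.{u, v}) (C : Type w) [L.Structure C] (κ : Cardinal.{w}) : Prop :=
  ∀ (A : Set C), #A < κ → ∀ (m : ℕ) (p : Set (L.Formula (A ⊕ Fin m))),
    (∀ q : Finset (L.Formula (A ⊕ Fin m)), (q : Set (L.Formula (A ⊕ Fin m))) ⊆ p →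
      ∃ x : Fin m → C, ∀ φ ∈ q, φ.Realize (Sum.elim (fun a : A => (a : C)) x)) →
    ∃ x : Fin m → C, ∀ φ ∈ p, φ.Realize (Sum.elim (fun a : A => (a : C)) x)

/-- `C` is strongly `κ`-homogeneous: every partial elementary map whose domain has fewer than `κ`
elements extends to an automorphism of `C`. -/
def IsStronglyHomogeneous (L : FirstOrder.Language.{u, v}) (C : Type w) [L.Structure C]
    (κ : Cardinal.{w}) : Prop :=
  ∀ (A : Set C) (f : A → C), #A < κ →
    (∀ φ : L.Formula A, φ.Realize f ↔ φ.Realize (fun a : A => (a : C))) →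
    ∃ σ : C ≃[L] C, ∀ a : A, σ a = f a

/-- `C` is a monster model for the small model `M`: it is `κ`-saturated and strongly
`κ`-homogeneous for an uncountable strong limit cardinal `κ` greater than the cardinalities of
`M` and of the language. "Bounded" means of cardinality less than `κ`. -/
structure IsMonster (L : FirstOrder.Language.{u, v}) (M : Type w') (C : Type w) [L.Structure C]
    (κ : Cardinal.{w}) : Prop where
  strongLimit : κ.IsStrongLimit
  aleph0_lt : ℵ₀ < κ
  card_language_lt : Cardinal.lift.{w} L.card < Cardinal.lift.{max u v} κ
  card_model_lt : Cardinal.lift.{w} #M < Cardinal.lift.{w'} κ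
  saturated : IsSaturated L C κ
  homogeneous : IsStronglyHomogeneous L C κ

/-! ### Definable groups and their interpretations -/

/-- A group `∅`-definable in `M`: its universe is the set of `n`-tuples defined by `dom`, and the
graph of its multiplication is defined by `mulGraph`. -/
structure DefinableGroup (L : FirstOrder.Language.{u, v}) (M : Type w') [L.Structure M] (n : ℕ) where
  dom : L.Formula (Fin n)
  mulGraph : L.Formula ((Fin n ⊕ Fin n) ⊕ Fin n)
  [group : Group {x : Fin n → M // dom.Realize x}]
  mulGraph_iff : ∀ x y z : {x : Fin n → M // dom.Realize x},
    mulGraph.Realize (Sum.elim (Sum.elim x.1 y.1) z.1) ↔ x * y = z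

section Interpretation

variable {L : FirstOrder.Language.{u, v}} {M : Type w'} {C : Type w} [L.Structure M] [L.Structure C] {n : ℕ}

/-- The group `G` of points in `M`. -/
abbrev Pt (𝒢 : DefinableGroup L M n) : Type w' := {x : Fin n → M // 𝒢.dom.Realize x}

instance (𝒢 : DefinableGroup L M n) : Group (Pt 𝒢) := 𝒢.group

/-- The interpretation `G*` of `G` in the elementary extension `j : M → C`. -/
@[ext]
structure StarPt (𝒢 : DefinableGroup L M n) (j : M ↪ₑ[L] C) : Type w where
  val : Fin n → C
  mem : 𝒢.dom.Realize val

open FirstOrder.Language in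
theorem transfer (j : M ↪ₑ[L] C) {α β : Type} [Finite β] (θ : L.Formula (α ⊕ β)) (c : α → M)
    (h : ∀ x : β → M, θ.Realize (Sum.elim c x)) (x : β → C) :
    θ.Realize (Sum.elim (j ∘ c) x) := by
  have h1 : (θ.iAlls β).Realize c := Formula.realize_iAlls.2 h
  have h2 := (j.map_formula (θ.iAlls β) c).2 h1
  exact Formula.realize_iAlls.1 h2 x

open FirstOrder.Language in
theorem transfer_exists (j : M ↪ₑ[L] C) {α β γ : Type} [Finite β] [Finite γ]
    (P : L.Formula (α ⊕ β)) (Q : L.Formula ((α ⊕ β) ⊕ γ)) (c : α → M)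
    (h : ∀ x : β → M, P.Realize (Sum.elim c x) →
      ∃ y : γ → M, Q.Realize (Sum.elim (Sum.elim c x) y))
    (x : β → C) (hx : P.Realize (Sum.elim (j ∘ c) x)) :
    ∃ y : γ → C, Q.Realize (Sum.elim (Sum.elim (j ∘ c) x) y) := by
  have := transfer j (P.imp (Q.iExs γ)) c
    (fun x => by
      simpa only [Formula.realize_imp, Formula.realize_iExs] using h x) x
  rw [Formula.realize_imp, Formula.realize_iExs] at this
  exact this hx

variable (𝒢 : DefinableGroup L M n) (j : M ↪ₑ[L] C)

/-- The inclusion of `G` in `G*`. -/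
def incl (g : Pt 𝒢) : StarPt 𝒢 j := ⟨j ∘ g.1, (j.map_formula _ _).2 g.2⟩

/-- The relation `x * y = z` on `G*` given by the interpretation of the graph of multiplication. -/
def MulRel (x y z : StarPt 𝒢 j) : Prop :=
  𝒢.mulGraph.Realize (Sum.elim (Sum.elim x.1 y.1) z.1)

open FirstOrder.Language in
theorem mulRel_total (x y : StarPt 𝒢 j) : ∃ z, MulRel 𝒢 j x y z := by
  have := transfer_exists j (α := Empty) (β := Fin n ⊕ Fin n) (γ := Fin n)
    (P := 𝒢.dom.relabel (fun i => Sum.inr (Sum.inl i)) ⊓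
      𝒢.dom.relabel (fun i => Sum.inr (Sum.inr i)))
    (Q := 𝒢.dom.relabel Sum.inr ⊓ 𝒢.mulGraph.relabel
      (Sum.elim (fun i => Sum.inl (Sum.inr i)) Sum.inr)) Empty.elim
    (fun x hx => by
      simp only [Formula.realize_inf, Formula.realize_relabel] at hx
      let a : Pt 𝒢 := ⟨_, hx.1⟩
      let b : Pt 𝒢 := ⟨_, hx.2⟩
      refine ⟨(a * b).1, ?_⟩
      simp only [Formula.realize_inf, Formula.realize_relabel]
      refine ⟨(a * b).2, ?_⟩
      have := (𝒢.mulGraph_iff a b (a * b)).2 rfl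
      convert this using 1
      ext ((i | i) | i) <;> rfl)
    (Sum.elim x.1 y.1)
    (by
      simp only [Formula.realize_inf, Formula.realize_relabel]
      exact ⟨x.2, y.2⟩)
  obtain ⟨z, hz⟩ := this
  simp only [Formula.realize_inf, Formula.realize_relabel] at hz
  refine ⟨⟨z, hz.1⟩, ?_⟩
  unfold MulRel
  convert hz.2 using 1
  ext ((i | i) | i) <;> rfl

/-- A formula in `k` tuple variables saying that all of them are in the group. -/
noncomputable def domAll (k : ℕ) : L.Formula (Empty ⊕ (Fin k × Fin n)) :=
  FirstOrder.Language.BoundedFormula.iInf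
    (fun i : Fin k => 𝒢.dom.relabel (fun l => Sum.inr (i, l)))

/-- The formula `x a * x b = x c`. -/
def mulAt {k : ℕ} (a b c : Fin k) : L.Formula (Empty ⊕ (Fin k × Fin n)) :=
  𝒢.mulGraph.relabel (Sum.elim (Sum.elim (fun i => Sum.inr (a, i)) (fun i => Sum.inr (b, i)))
    (fun i => Sum.inr (c, i)))

/-- The formula `x a = x b` in the coordinate `l`. -/
def eqAt {k : ℕ} (a b : Fin k) (l : Fin n) : L.Formula (Empty ⊕ (Fin k × Fin n)) :=
  (FirstOrder.Language.Term.var (Sum.inr (a, l))).equal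
    (FirstOrder.Language.Term.var (Sum.inr (b, l)))

open FirstOrder.Language in
theorem realize_mulAt {N : Type*} [L.Structure N] {k : ℕ} (a b c : Fin k)
    (x : Fin k × Fin n → N) (z : Empty → N) :
    (mulAt 𝒢 a b c).Realize (Sum.elim z x) ↔
      𝒢.mulGraph.Realize (Sum.elim (Sum.elim (fun i => x (a, i)) (fun i => x (b, i)))
        (fun i => x (c, i))) := by
  rw [mulAt, Formula.realize_relabel]
  apply iff_of_eq
  congr 1
  ext ((i | i) | i) <;> rfl

open FirstOrder.Language in
/-- Transfer to `G*` of a universal statement about products of `k` elements. -/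
theorem transfer_mul {k : ℕ} (s : List (Fin k × Fin k × Fin k)) (p q : Fin k)
    (h : ∀ x : Fin k → Pt 𝒢, (∀ t ∈ s, x t.1 * x t.2.1 = x t.2.2) → x p = x q)
    (x : Fin k → StarPt 𝒢 j) (hx : ∀ t ∈ s, MulRel 𝒢 j (x t.1) (x t.2.1) (x t.2.2)) :
    x p = x q := by
  apply StarPt.ext
  funext l
  have := transfer j (α := Empty) (β := Fin k × Fin n)
    ((domAll 𝒢 k).imp
      ((BoundedFormula.iInf (fun i : Fin s.length =>
          mulAt 𝒢 (s.get i).1 (s.get i).2.1 (s.get i).2.2)).imp (eqAt p q l : L.Formula _)))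
    Empty.elim
    (fun x => by
      rw [Formula.realize_imp, Formula.realize_imp]
      intro h1 h2
      have h1' : ∀ i : Fin k, 𝒢.dom.Realize (fun l => x (i, l)) := by
        intro i
        have := (BoundedFormula.realize_iInf.1 h1) i
        exact (Formula.realize_relabel (v := Sum.elim Empty.elim x)).1 this
      have h2' : ∀ i : Fin s.length, 𝒢.mulGraph.Realize _ := fun i =>
        (realize_mulAt 𝒢 _ _ _ x _).1 ((BoundedFormula.realize_iInf.1 h2) i)
      have := h (fun i => ⟨_, h1' i⟩) (fun t ht => by
        obtain ⟨i, rfl⟩ := List.get_of_mem ht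
        exact (𝒢.mulGraph_iff _ _ _).1 (h2' i))
      exact congrFun (congrArg Subtype.val this) l)
    (fun t => (x t.1).1 t.2)
  rw [Formula.realize_imp, Formula.realize_imp] at this
  refine this ?_ ?_
  · refine BoundedFormula.realize_iInf.2 (fun i => ?_)
    exact Formula.realize_relabel.2 (x i).2
  · refine BoundedFormula.realize_iInf.2 (fun i => ?_)
    exact (realize_mulAt 𝒢 _ _ _ _ _).2 (hx _ (List.get_mem s i))

theorem incl_mulRel (a b : Pt 𝒢) : MulRel 𝒢 j (incl 𝒢 j a) (incl 𝒢 j b) (incl 𝒢 j (a * b)) := by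
  have h := (j.map_formula 𝒢.mulGraph _).2 ((𝒢.mulGraph_iff a b (a * b)).2 rfl)
  unfold MulRel
  convert h using 1
  ext ((i | i) | i) <;> rfl

theorem mulRel_unique (x y z z' : StarPt 𝒢 j) (h : MulRel 𝒢 j x y z) (h' : MulRel 𝒢 j x y z') :
    z = z' :=
  transfer_mul 𝒢 j (k := 4) [(0, 1, 2), (0, 1, 3)] 2 3
    (fun x hx => (hx (0, 1, 2) (by simp)).symm.trans (hx (0, 1, 3) (by simp)))
    ![x, y, z, z'] (by simpa using ⟨h, h'⟩)

noncomputable instance : Mul (StarPt 𝒢 j) := ⟨fun x y => (mulRel_total 𝒢 j x y).choose⟩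

theorem mulRel_mul (x y : StarPt 𝒢 j) : MulRel 𝒢 j x y (x * y) :=
  (mulRel_total 𝒢 j x y).choose_spec

theorem mulRel_iff (x y z : StarPt 𝒢 j) : MulRel 𝒢 j x y z ↔ x * y = z :=
  ⟨fun h => mulRel_unique 𝒢 j x y _ _ (mulRel_mul 𝒢 j x y) h, fun h => h ▸ mulRel_mul 𝒢 j x y⟩

theorem incl_mul' (a b : Pt 𝒢) : incl 𝒢 j (a * b) = incl 𝒢 j a * incl 𝒢 j b :=
  ((mulRel_iff 𝒢 j _ _ _).1 (incl_mulRel 𝒢 j a b)).symm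

theorem star_assoc (x y z : StarPt 𝒢 j) : x * y * z = x * (y * z) :=
  transfer_mul 𝒢 j (k := 7) [(0, 1, 3), (3, 2, 4), (1, 2, 5), (0, 5, 6)] 4 6
    (fun x hx => by
      rw [← hx (3, 2, 4) (by simp), ← hx (0, 5, 6) (by simp), ← hx (0, 1, 3) (by simp),
        ← hx (1, 2, 5) (by simp), mul_assoc])
    ![x, y, z, x * y, x * y * z, y * z, x * (y * z)]
    (by simp [mulRel_iff])

theorem star_one_mul (x : StarPt 𝒢 j) : incl 𝒢 j 1 * x = x := by
  have h1 : incl 𝒢 j 1 * incl 𝒢 j 1 = incl 𝒢 j 1 := by rw [← incl_mul', one_mul]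
  exact transfer_mul 𝒢 j (k := 3) [(0, 0, 0), (0, 1, 2)] 2 1
    (fun x hx => by
      have h := hx (0, 0, 0) (by simp)
      have h' := hx (0, 1, 2) (by simp)
      have h0 : x 0 = 1 := mul_eq_left.1 h
      rw [← h', h0, one_mul])
    ![incl 𝒢 j 1, x, incl 𝒢 j 1 * x] (by simpa [mulRel_iff] using h1)

open FirstOrder.Language in
theorem star_exists_inv (x : StarPt 𝒢 j) : ∃ y : StarPt 𝒢 j, y * x = incl 𝒢 j 1 := by
  obtain ⟨y, hy⟩ := transfer_exists j (α := Fin n) (β := Fin n) (γ := Fin n)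
    (P := 𝒢.dom.relabel Sum.inr)
    (Q := 𝒢.dom.relabel Sum.inr ⊓ 𝒢.mulGraph.relabel
      (Sum.elim (Sum.elim Sum.inr (fun i => Sum.inl (Sum.inr i))) (fun i => Sum.inl (Sum.inl i))))
    (1 : Pt 𝒢).1
    (fun x hx => by
      rw [Formula.realize_relabel] at hx
      let a : Pt 𝒢 := ⟨_, hx⟩
      refine ⟨(a⁻¹).1, ?_⟩
      rw [Formula.realize_inf, Formula.realize_relabel, Formula.realize_relabel]
      refine ⟨(a⁻¹).2, ?_⟩
      have := (𝒢.mulGraph_iff (a⁻¹ : Pt 𝒢) a (1 : Pt 𝒢)).2 (inv_mul_cancel a)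
      convert this using 1
      ext ((i | i) | i) <;> rfl)
    x.1 (Formula.realize_relabel.2 x.2)
  rw [Formula.realize_inf, Formula.realize_relabel, Formula.realize_relabel] at hy
  refine ⟨⟨y, hy.1⟩, (mulRel_iff 𝒢 j _ _ _).1 ?_⟩
  unfold MulRel
  convert hy.2 using 1
  ext ((i | i) | i) <;> rfl

noncomputable instance : One (StarPt 𝒢 j) := ⟨incl 𝒢 j 1⟩

noncomputable instance : Inv (StarPt 𝒢 j) := ⟨fun x => (star_exists_inv 𝒢 j x).choose⟩

/-- The group structure of `G*`, with multiplication the interpretation of `mulGraph` in `C`. -/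
noncomputable instance : Group (StarPt 𝒢 j) :=
  Group.ofLeftAxioms (star_assoc 𝒢 j) (star_one_mul 𝒢 j)
    (fun x => (star_exists_inv 𝒢 j x).choose_spec)

/-- The inclusion of `G` in `G*` as a homomorphism. -/
noncomputable def inclHom : Pt 𝒢 →* StarPt 𝒢 j :=
  MonoidHom.mk' (incl 𝒢 j) (incl_mul' 𝒢 j)

end Interpretation

/-! ### `Δ`-definability -/

section Delta

variable {L : FirstOrder.Language.{u, v}} {M : Type w'} {C : Type w} [L.Structure M]
  [L.Structure C] {n : ℕ}

/-- A set `Δ` of formulas `δ(x; y, z, t) = ψ(y * x * z; t)` is given by the set of the formulas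
`ψ(x; t)`, where `x` is an `n`-tuple and `t` is a `k`-tuple of variables, `k` arbitrary. -/
abbrev FormulaSet (L : FirstOrder.Language.{u, v}) (n : ℕ) : Type (max u v) :=
  Set (Σ k : ℕ, L.Formula (Fin n ⊕ Fin k))

/-- The formula `ψ(x)` defining `G`; the corresponding `δ` is `G(y * x * z)`. -/
def domFormula (𝒢 : DefinableGroup L M n) : Σ k : ℕ, L.Formula (Fin n ⊕ Fin k) :=
  ⟨0, 𝒢.dom.relabel Sum.inl⟩

/-- The `Δ`-definable (over `M`) subsets of `G`: Boolean combinations of instances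
`ψ(a * x * b; c)` with parameters `a, b` from `G` and `c` from `M`. -/
def deltaSets (𝒢 : DefinableGroup L M n) (Δ : FormulaSet L n) : BooleanSubalgebra (Set (Pt 𝒢)) :=
  BooleanSubalgebra.closure {D | ∃ ψ ∈ Δ, ∃ (a b : Pt 𝒢) (c : Fin ψ.1 → M),
    D = {g | ψ.2.Realize (Sum.elim (a * g * b).1 c)}}

/-- The subsets of `G*` that are `Δ`-definable over `M`. -/
def deltaSetsStar (𝒢 : DefinableGroup L M n) (j : M ↪ₑ[L] C) (Δ : FormulaSet L n) :
    BooleanSubalgebra (Set (StarPt 𝒢 j)) :=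
  BooleanSubalgebra.closure {D | ∃ ψ ∈ Δ, ∃ (a b : Pt 𝒢) (c : Fin ψ.1 → M),
    D = {g | ψ.2.Realize (Sum.elim (incl 𝒢 j a * g * incl 𝒢 j b).1 (j ∘ c))}}

/-- `D ⊆ G*` is `Δ`-type-definable over `M`. -/
def IsDeltaTypeDefinable (𝒢 : DefinableGroup L M n) (j : M ↪ₑ[L] C) (Δ : FormulaSet L n)
    (D : Set (StarPt 𝒢 j)) : Prop :=
  ∃ S : Set (Set (StarPt 𝒢 j)), (∀ s ∈ S, s ∈ deltaSetsStar 𝒢 j Δ) ∧ D = ⋂₀ S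

/-- `D ⊆ G*` is type-definable over `M`. -/
def IsTypeDefinable (𝒢 : DefinableGroup L M n) (j : M ↪ₑ[L] C) (D : Set (StarPt 𝒢 j)) : Prop :=
  ∃ S : Set (Set (Fin n → C)), (∀ s ∈ S, (Set.range j).Definable L s) ∧
    D = {g | ∀ s ∈ S, g.1 ∈ s}

/-- The topology on `G*` whose closed sets are the sets type-definable over `M`. The quotient
topology that it induces on a quotient `G*/E` is the logic topology: a subset of `G*/E` is closed
if and only if its preimage in `G*` is type-definable over `M`. -/
instance (𝒢 : DefinableGroup L M n) (j : M ↪ₑ[L] C) : TopologicalSpace (StarPt 𝒢 j) :=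
  TopologicalSpace.ofClosed {D | IsTypeDefinable 𝒢 j D}
    ⟨{∅}, by simp, by simp⟩
    (by
      intro A hA
      refine ⟨{s | (Set.range j).Definable L s ∧ ∃ D ∈ A, ∀ g ∈ D, g.1 ∈ s}, fun s hs => hs.1, ?_⟩
      ext g
      simp only [Set.mem_sInter, Set.mem_ofPred_eq]
      constructor
      · rintro h s ⟨-, D, hD, hs⟩
        exact hs g (h D hD)
      · intro h D hD
        obtain ⟨S, hS, rfl⟩ := hA hD
        intro s hs
        exact h s ⟨hS s hs, _, hD, fun g hg => hg s hs⟩)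
    (by
      rintro _ ⟨S, hS, rfl⟩ _ ⟨T, hT, rfl⟩
      refine ⟨{r | ∃ s ∈ S, ∃ t ∈ T, r = s ∪ t}, ?_, ?_⟩
      · rintro _ ⟨s, hs, t, ht, rfl⟩
        exact (hS s hs).union (hT t ht)
      · ext g
        simp only [Set.mem_union, Set.mem_ofPred_eq]
        constructor
        · rintro (h | h) _ ⟨s, hs, t, ht, rfl⟩
          · exact Or.inl (h s hs)
          · exact Or.inr (h t ht)
        · intro h
          by_contra hc
          push Not at hc
          obtain ⟨⟨s, hs, hs'⟩, t, ht, ht'⟩ := hc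
          exact (h _ ⟨s, hs, t, ht, rfl⟩).elim hs' ht')

/-- A map `f : G → X` to a compact space is `Δ`-definable: the preimages of disjoint closed sets
are separated by a `Δ`-definable set. -/
def IsDeltaDefinableMap (𝒢 : DefinableGroup L M n) (Δ : FormulaSet L n) {X : Type*}
    [TopologicalSpace X] (f : Pt 𝒢 → X) : Prop :=
  ∀ C₁ C₂ : Set X, IsClosed C₁ → IsClosed C₂ → Disjoint C₁ C₂ →
    ∃ D ∈ deltaSets 𝒢 Δ, f ⁻¹' C₁ ⊆ D ∧ Disjoint D (f ⁻¹' C₂)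

/-- A map `f : G* → X` to a compact space is `Δ`-definable over `M`: the preimages of closed sets
are `Δ`-type-definable over `M`. -/
def IsDeltaDefinableStarMap (𝒢 : DefinableGroup L M n) (j : M ↪ₑ[L] C) (Δ : FormulaSet L n)
    {X : Type*} [TopologicalSpace X] (f : StarPt 𝒢 j → X) : Prop :=
  ∀ C₁ : Set X, IsClosed C₁ → IsDeltaTypeDefinable 𝒢 j Δ (f ⁻¹' C₁)

/-- `(G, X, x)` is a `Δ`-definable `G`-ambit: `X` is compact Hausdorff, `G` acts on `X` by
homeomorphisms, all the orbit maps `g ↦ g y` are `Δ`-definable, and the orbit of `x` is dense. -/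
structure IsDeltaAmbit (𝒢 : DefinableGroup L M n) (Δ : FormulaSet L n) (X : Type*)
    [TopologicalSpace X] [MulAction (Pt 𝒢) X] (x : X) : Prop where
  compact : CompactSpace X
  hausdorff : T2Space X
  continuous_smul : ∀ g : Pt 𝒢, Continuous (fun y : X => g • y)
  definable : ∀ y : X, IsDeltaDefinableMap 𝒢 Δ (fun g => g • y)
  dense : Dense (Set.range (fun g : Pt 𝒢 => g • x))

/-- The equivalence relation `E'_Δ` on `G*`, the kernel of the map `f_x* : G* → 𝒰`, where
`(𝒰, x)` is the universal `Δ`-definable `G`-ambit and `f_x*` is the extension of the orbit map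
`g ↦ g x` to a map on `G*` that is `Δ`-definable over `M`. The universal ambit is the closure of
the orbit of `(x_i)` in the product of all `Δ`-definable ambits `(X_i, x_i)`; so `a` and `b` are
equivalent if and only if, for each `Δ`-definable ambit `(X, x)`, the extension of `g ↦ g x` takes
the same value at `a` and at `b`. (By density of an orbit of `G`, all ambits are isomorphic to
ambits in the universe of `C`.) -/
def ambitRel (𝒢 : DefinableGroup L M n) (j : M ↪ₑ[L] C) (Δ : FormulaSet L n) :
    Setoid (StarPt 𝒢 j) where
  r a b := ∀ (X : Type w) [TopologicalSpace X] [MulAction (Pt 𝒢) X] (x : X),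
    IsDeltaAmbit 𝒢 Δ X x → ∀ f : StarPt 𝒢 j → X, IsDeltaDefinableStarMap 𝒢 j Δ f →
      (∀ g : Pt 𝒢, f (incl 𝒢 j g) = g • x) → f a = f b
  iseqv :=
    ⟨fun _ _ _ _ _ _ _ _ _ => rfl, fun h X _ _ x hx f hf hfx => (h X x hx f hf hfx).symm,
      fun h h' X _ _ x hx f hf hfx => (h X x hx f hf hfx).trans (h' X x hx f hf hfx)⟩

theorem translate_mem (𝒢 : DefinableGroup L M n) (j : M ↪ₑ[L] C) (Δ : FormulaSet L n) (g : Pt 𝒢)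
    (D : Set (StarPt 𝒢 j)) (hD : D ∈ deltaSetsStar 𝒢 j Δ) :
    (fun a => incl 𝒢 j g * a) ⁻¹' D ∈ deltaSetsStar 𝒢 j Δ := by
  refine BooleanSubalgebra.closure_bot_sup_induction
    (p := fun D _ => (fun a => incl 𝒢 j g * a) ⁻¹' D ∈ deltaSetsStar 𝒢 j Δ)
    ?_ ?_ ?_ ?_ hD
  · rintro _ ⟨ψ, hψ, a, b, c, rfl⟩
    refine BooleanSubalgebra.subset_closure ⟨ψ, hψ, a * g, b, c, ?_⟩
    ext x
    simp only [Set.mem_preimage, Set.mem_ofPred_eq, incl_mul', mul_assoc]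
  · exact BooleanSubalgebra.bot_mem
  · intro x _ y _ hx hy
    exact BooleanSubalgebra.sup_mem hx hy
  · intro x _ hx
    exact BooleanSubalgebra.compl_mem hx

theorem ambitRel_smul (𝒢 : DefinableGroup L M n) (j : M ↪ₑ[L] C) (Δ : FormulaSet L n) (g : Pt 𝒢)
    (a b : StarPt 𝒢 j) (h : (ambitRel 𝒢 j Δ).r a b) :
    (ambitRel 𝒢 j Δ).r (incl 𝒢 j g * a) (incl 𝒢 j g * b) := by
  intro X _ _ x hx f hf hfx
  have key := h X x hx (fun a => g⁻¹ • f (incl 𝒢 j g * a)) (fun C₁ hC => by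
    obtain ⟨S, hS, e⟩ := hf _ (hC.preimage (hx.continuous_smul g⁻¹))
    refine ⟨(fun D => (fun a => incl 𝒢 j g * a) ⁻¹' D) '' S, ?_, ?_⟩
    · rintro _ ⟨D, hD, rfl⟩
      exact translate_mem 𝒢 j Δ g D (hS D hD)
    · have e' : (fun a => g⁻¹ • f (incl 𝒢 j g * a)) ⁻¹' C₁ =
          (fun a => incl 𝒢 j g * a) ⁻¹' (f ⁻¹' ((fun y => g⁻¹ • y) ⁻¹' C₁)) := rfl
      rw [e', e, Set.preimage_sInter, Set.sInter_image])
    (fun k => by rw [← incl_mul', hfx, mul_smul, inv_smul_smul])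
  simpa using key

/-- The universal `Δ`-definable `G`-ambit `G*/E'_Δ`, with the logic topology. -/
abbrev Univ (𝒢 : DefinableGroup L M n) (j : M ↪ₑ[L] C) (Δ : FormulaSet L n) : Type w :=
  Quotient (ambitRel 𝒢 j Δ)

/-- The class `a/E'_Δ`. -/
def toUniv (𝒢 : DefinableGroup L M n) (j : M ↪ₑ[L] C) (Δ : FormulaSet L n) (a : StarPt 𝒢 j) :
    Univ 𝒢 j Δ := Quotient.mk (ambitRel 𝒢 j Δ) a

/-- The action `g (a/E'_Δ) = (g a)/E'_Δ` of `G`. -/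
noncomputable instance (𝒢 : DefinableGroup L M n) (j : M ↪ₑ[L] C) (Δ : FormulaSet L n) :
    MulAction (Pt 𝒢) (Univ 𝒢 j Δ) where
  smul g := Quotient.map' (fun a => incl 𝒢 j g * a) (fun a b h => ambitRel_smul 𝒢 j Δ g a b h)
  one_smul := by
    rintro ⟨a⟩
    exact congrArg (Quotient.mk _) (one_mul a)
  mul_smul := by
    rintro g h ⟨a⟩
    refine congrArg (Quotient.mk _) ?_
    change incl 𝒢 j (g * h) * a = incl 𝒢 j g * (incl 𝒢 j h * a)
    rw [incl_mul', mul_assoc]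

instance (𝒢 : DefinableGroup L M n) (j : M ↪ₑ[L] C) (Δ : FormulaSet L n) :
    Nonempty (Univ 𝒢 j Δ) := ⟨toUniv 𝒢 j Δ 1⟩

/-- The semigroup operation `p * q = lim_{g → p} g q`, where `g → p` means that `g/E'_Δ` tends to
`p` with `g` ranging over `G`. -/
noncomputable instance (𝒢 : DefinableGroup L M n) (j : M ↪ₑ[L] C) (Δ : FormulaSet L n) :
    Mul (Univ 𝒢 j Δ) :=
  ⟨fun p q => limUnder (comap (fun g : Pt 𝒢 => toUniv 𝒢 j Δ (incl 𝒢 j g)) (𝓝 p))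
    (fun g : Pt 𝒢 => g • q)⟩

end Delta

/-! ### Minimal left ideals, the Ellis group and the `τ`-topology -/

/-- `I` is a minimal left ideal of `S`. -/
def IsMinimalLeftIdeal {S : Type*} [Mul S] (I : Set S) : Prop :=
  Minimal (fun J : Set S => J.Nonempty ∧ ∀ p : S, ∀ m ∈ J, p * m ∈ J) I

section Ellis

variable {L : FirstOrder.Language.{u, v}} {M : Type w'} {C : Type w} [L.Structure M]
  [L.Structure C] {n : ℕ} {𝒢 : DefinableGroup L M n} {j : M ↪ₑ[L] C} {Δ : FormulaSet L n}

/-- `p ∘ A`: the set of all limits of `g_i x_i`, for nets `x_i` in `A` and `g_i` in `G` such that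
`g_i/E'_Δ` tends to `p`. A net of pairs `(g_i, x_i)` is represented by a proper filter. -/
def circ (p : Univ 𝒢 j Δ) (A : Set (Univ 𝒢 j Δ)) : Set (Univ 𝒢 j Δ) :=
  {x | ∃ F : Filter (Pt 𝒢 × Univ 𝒢 j Δ), F.NeBot ∧ (∀ᶠ z in F, z.2 ∈ A) ∧
    Tendsto (fun z => toUniv 𝒢 j Δ (incl 𝒢 j z.1)) F (𝓝 p) ∧
    Tendsto (fun z => z.1 • z.2) F (𝓝 x)}

/-- The Ellis group `uℳ`, for a minimal left ideal `I = ℳ` and an idempotent `u`. -/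
@[ext]
structure EllisGroup (I : Set (Univ 𝒢 j Δ)) (u : Univ 𝒢 j Δ) : Type w where
  val : Univ 𝒢 j Δ
  mem : ∃ m ∈ I, u * m = val

variable {I : Set (Univ 𝒢 j Δ)} {u : Univ 𝒢 j Δ}

/-- The element `u` of `uℳ`. -/
def ellisUnit (hu : u ∈ I) (huu : u * u = u) : EllisGroup I u := ⟨u, u, hu, huu⟩

/-- `cl_τ(A) = (u ∘ A) ∩ uℳ`. -/
def clTau (A : Set (EllisGroup I u)) : Set (EllisGroup I u) :=
  {x | x.1 ∈ circ u (EllisGroup.val '' A)}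

theorem clTau_mono {A B : Set (EllisGroup I u)} (h : A ⊆ B) : clTau A ⊆ clTau B := by
  rintro x ⟨F, h1, h2, h3⟩
  exact ⟨F, h1, h2.mono fun z hz => Set.image_mono h hz, h3⟩

/-- The `τ`-topology on `uℳ`: a set is closed if and only if it contains its `cl_τ`. -/
instance : TopologicalSpace (EllisGroup I u) :=
  TopologicalSpace.ofClosed {A | clTau A ⊆ A}
    (by
      rintro x ⟨F, h1, h2, -⟩
      obtain ⟨z, y, hy, -⟩ := h2.exists
      exact absurd hy (Set.notMem_empty y))
    (fun A hA => Set.subset_sInter fun B hB =>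
      (clTau_mono (Set.sInter_subset_of_mem hB)).trans (hA hB))
    (by
      rintro A hA B hB x ⟨F, h1, h2, h3, h4⟩
      rw [Set.image_union] at h2
      by_cases h : ∃ᶠ z in F, z.2 ∈ (EllisGroup.val '' A : Set (Univ 𝒢 j Δ))
      · refine Or.inl (hA ⟨F ⊓ 𝓟 {z | z.2 ∈ (EllisGroup.val '' A : Set (Univ 𝒢 j Δ))},
          Filter.frequently_mem_iff_neBot.1 h, ?_, h3.mono_left inf_le_left,
          h4.mono_left inf_le_left⟩)
        exact Filter.mem_inf_of_right (Filter.mem_principal_self _)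
      · rw [Filter.not_frequently] at h
        refine Or.inr (hB ⟨F, h1, ?_, h3, h4⟩)
        filter_upwards [h, h2] with z hz hz'
        exact hz'.resolve_left hz)

/-- `H(uℳ)`: the intersection of `cl_τ(V)` over all `τ`-neighbourhoods `V` of the identity `e` of
`uℳ`. -/
def ellisH (e : EllisGroup I u) : Set (EllisGroup I u) := ⋂ V ∈ 𝓝 e, clTau V

end Ellis

/-! ### The connected component -/

section Component

variable {L : FirstOrder.Language.{u, v}} {M : Type w'} {C : Type w} [L.Structure M]
  [L.Structure C] {n : ℕ}

/-- The smallest `Δ`-type-definable over `M` subgroup of `G*` of bounded index (index less than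
`κ`), that is, the intersection of all such subgroups. -/
noncomputable def component (𝒢 : DefinableGroup L M n) (j : M ↪ₑ[L] C) (Δ : FormulaSet L n)
    (κ : Cardinal.{w}) : Subgroup (StarPt 𝒢 j) :=
  sInf {H | IsDeltaTypeDefinable 𝒢 j Δ (H : Set (StarPt 𝒢 j)) ∧ #(StarPt 𝒢 j ⧸ H) < κ}

end Component

end DeltaFlow

open DeltaFlow

/-! Besides the topology of sets type-definable over $M$, give $G^*$ the coarser topology whose
closed sets are the $\Delta$-type-definable ones. Saturation makes both compact. Elementarity makes
$G$ dense. Since instances of $\Delta$ absorb parameters from $G$ on both sides, left and right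
translations by elements of $G$ are continuous for the $\Delta$-topology.

The ambit: $E'_\Delta$ is the kernel of evaluation at the continuous $\varphi:G^*\to[0,1]$ all of
whose orbit maps $g\mapsto\varphi(ga)$ extend continuously to $G^*$ (`orbitFunctions`). Hence
$G^*/E'_\Delta$ is a closed subspace of a cube. Its orbit maps extend to the whole ambit, so the
limits defining $p*q$ exist, $p\mapsto p*q$ is continuous, and associativity follows by density of
$G$.

The Ellis group: the inclusion $p\circ(q\circ A)\subseteq(p*q)\circ A$ (`circ_circ_subset`) shows
that $\operatorname{cl}_\tau$ is the closure operator of the $\tau$-topology and that left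
translations are $\tau$-continuous; right translations are so by continuity of $p\mapsto p*q$. In
any group with separately continuous multiplication the points not separated from the identity form
a normal subgroup, and here this is $H(u\mathcal M)$.

The component: the heart is `IsMonster.inv_mul_mem_of_deltaType_eq`, by which cosets of a
$\Delta$-type-definable subgroup of bounded index depend only on $\Delta$-types over $M$. So
type-definable conditions invariant under the component are closed already in the $\Delta$-topology,
and the quotient by the component is a compact Hausdorff topological group. With $G$ acting by
translation it is a $\Delta$-definable ambit, so $E'_\Delta$ refines the coset relation by
universality, and the induced map $\hat\theta$ is a continuous homomorphism.

The conclusion: if $g_i\to u$ and $g_ix_i\to x$, then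
$\hat\theta(x_i)=\hat\theta(g_i)^{-1}\hat\theta(g_ix_i)\to\hat\theta(u)^{-1}\hat\theta(x)=\hat\theta(x)$,
because $\hat\theta(u)$ is an idempotent of a group. So preimages of closed sets are $\tau$-closed.
The target being Hausdorff, points not separated from $u$ go to $1$. -/

namespace DeltaFlow

/-! ### Realizing filters in saturated structures -/

section Saturation

variable {L : FirstOrder.Language.{u, v}} {M : Type w'} {C : Type w} [L.Structure M]
  [L.Structure C] {n : ℕ} {κ : Cardinal.{w}}

open FirstOrder.Language in
/-- In a `κ`-saturated structure, the sets of a proper filter on tuples that are definable over a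
set of fewer than `κ` parameters have a common element. -/
theorem IsSaturated.exists_mem_of_filter (hC : IsSaturated L C κ) {A : Set C} (hA : #A < κ)
    {α : Type*} [Finite α] (W : Filter (α → C)) [W.NeBot] :
    ∃ c : α → C, ∀ s, A.Definable L s → s ∈ W → c ∈ s := by
  obtain ⟨m, ⟨e⟩⟩ := Finite.exists_equiv_fin α
  obtain ⟨x, hx⟩ := hC A hA m
    -- The type to realize consists of all formulas over `A` whose solution sets lie in `W`; it is
    -- finitely satisfiable because `W` is proper.
    {φ | {y : α → C | φ.Realize (Sum.elim (fun a : A => (a : C)) (y ∘ e.symm))} ∈ W} (by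
      intro q hq
      have h : ⋂ φ ∈ q, {y : α → C | φ.Realize (Sum.elim (fun a : A => (a : C)) (y ∘ e.symm))} ∈ W :=
        (Filter.biInter_finset_mem q).2 fun φ hφ => hq hφ
      obtain ⟨y, hy⟩ := Filter.nonempty_of_mem h
      exact ⟨y ∘ e.symm, fun φ hφ => Set.mem_iInter₂.1 hy φ hφ⟩)
  refine ⟨x ∘ e, fun s hs hsW => ?_⟩
  obtain ⟨φ, rfl⟩ := Set.definable_iff_exists_formula_sum.1 hs
  have key : ∀ y : α → C,
      (φ.relabel (Sum.map id e)).Realize (Sum.elim (fun a : A => (a : C)) (y ∘ e.symm)) ↔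
        φ.Realize (Sum.elim (fun a : A => (a : C)) y) := by
    intro y
    rw [Formula.realize_relabel]
    apply iff_of_eq
    congr 1
    ext (i | i) <;> simp
  have hx' := hx (φ.relabel (Sum.map id e)) (by
    refine Filter.mem_of_superset hsW fun y hy => ?_
    exact (key y).2 hy)
  have := (key (x ∘ e)).1 (by simpa [Function.comp_assoc] using hx')
  exact this

/-! ### Definable subsets of $G^*$ and $G^*\times G^*$ -/

variable {𝒢 : DefinableGroup L M n} {j : M ↪ₑ[L] C}

/-- `D ⊆ G*` is definable over `A`. -/
def IsDefinableOver (A : Set C) (D : Set (StarPt 𝒢 j)) : Prop :=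
  ∃ T : Set (Fin n → C), A.Definable L T ∧ ∀ x, x ∈ D ↔ x.1 ∈ T

/-- `D ⊆ G* × G*` is definable over `A`. -/
def IsDefinableOver₂ (A : Set C) (D : Set (StarPt 𝒢 j × StarPt 𝒢 j)) : Prop :=
  ∃ T : Set (Fin n ⊕ Fin n → C), A.Definable L T ∧ ∀ x y, (x, y) ∈ D ↔ Sum.elim x.1 y.1 ∈ T

theorem IsDefinableOver.mono {A B : Set C} {D : Set (StarPt 𝒢 j)} (h : IsDefinableOver A D)
    (hAB : A ⊆ B) : IsDefinableOver B D :=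
  let ⟨T, hT, e⟩ := h
  ⟨T, hT.mono hAB, e⟩

theorem IsDefinableOver.compl {A : Set C} {D : Set (StarPt 𝒢 j)} (h : IsDefinableOver A D) :
    IsDefinableOver A Dᶜ :=
  let ⟨T, hT, e⟩ := h
  ⟨Tᶜ, hT.compl, fun x => not_congr (e x)⟩

theorem IsDefinableOver.union {A : Set C} {D E : Set (StarPt 𝒢 j)} (h : IsDefinableOver A D)
    (h' : IsDefinableOver A E) : IsDefinableOver A (D ∪ E) :=
  let ⟨T, hT, e⟩ := h
  let ⟨T', hT', e'⟩ := h'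
  ⟨T ∪ T', hT.union hT', fun x => or_congr (e x) (e' x)⟩

theorem isDefinableOver_empty (A : Set C) : IsDefinableOver A (∅ : Set (StarPt 𝒢 j)) :=
  ⟨∅, Set.definable_empty, fun _ => Iff.rfl⟩

theorem IsDefinableOver.preimage_fst {A : Set C} {D : Set (StarPt 𝒢 j)}
    (h : IsDefinableOver A D) : IsDefinableOver₂ A (Prod.fst ⁻¹' D) :=
  let ⟨_, hT, e⟩ := h
  ⟨_, hT.preimage_comp Sum.inl, fun x _ => e x⟩

theorem IsDefinableOver.preimage_snd {A : Set C} {D : Set (StarPt 𝒢 j)}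
    (h : IsDefinableOver A D) : IsDefinableOver₂ A (Prod.snd ⁻¹' D) :=
  let ⟨_, hT, e⟩ := h
  ⟨_, hT.preimage_comp Sum.inr, fun _ y => e y⟩

open FirstOrder.Language in
theorem definable_realize (A : Set C) {α : Type*} (φ : L.Formula α) :
    A.Definable L {v : α → C | φ.Realize v} :=
  (Set.empty_definable_iff.2 ⟨φ, rfl⟩).mono (Set.empty_subset A)

open FirstOrder.Language in
theorem IsDefinableOver₂.left_slice {A : Set C} {D : Set (StarPt 𝒢 j × StarPt 𝒢 j)}
    (h : IsDefinableOver₂ A D) (x : StarPt 𝒢 j) (hx : ∀ i, x.1 i ∈ A) :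
    IsDefinableOver A {y | (x, y) ∈ D} := by
  obtain ⟨T, hT, e⟩ := h
  refine ⟨(fun v => Sum.elim x.1 v) ⁻¹' T, hT.preimage_map ?_, fun y => e x y⟩
  rintro (i | i)
  · exact definableFun_const L _ (hx i)
  · exact Set.DefinableFun.proj L

open FirstOrder.Language in
theorem IsDefinableOver₂.right_slice {A : Set C} {D : Set (StarPt 𝒢 j × StarPt 𝒢 j)}
    (h : IsDefinableOver₂ A D) (y : StarPt 𝒢 j) (hy : ∀ i, y.1 i ∈ A) :
    IsDefinableOver A {x | (x, y) ∈ D} := by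
  obtain ⟨T, hT, e⟩ := h
  refine ⟨(fun v => Sum.elim v y.1) ⁻¹' T, hT.preimage_map ?_, fun x => e x y⟩
  rintro (i | i)
  · exact Set.DefinableFun.proj L
  · exact definableFun_const L _ (hy i)

open FirstOrder.Language in
/-- The set of pairs `(x, y)` with `x⁻¹ * (c * y * d) ∈ D` is definable. -/
theorem IsDefinableOver.inv_mul {A : Set C} {D : Set (StarPt 𝒢 j)} (h : IsDefinableOver A D)
    (c d : StarPt 𝒢 j) (hc : ∀ i, c.1 i ∈ A) (hd : ∀ i, d.1 i ∈ A) :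
    IsDefinableOver₂ A {z | z.1⁻¹ * (c * z.2 * d) ∈ D} := by
  obtain ⟨T, hT, e⟩ := h
  -- Besides `x` and `y` there are three tuples to be quantified away: `z = c * y`, `t = z * d`, and
  -- `r = x⁻¹ * t`, expressed without inverses as `x * r = t`. They must be required to lie in the
  -- group, since `mulGraph` is controlled only there.
  let V := (Fin n ⊕ Fin n) ⊕ ((Fin n ⊕ Fin n) ⊕ Fin n)
  let x : (V → C) → Fin n → C := fun v i => v (.inl (.inl i))
  let y : (V → C) → Fin n → C := fun v i => v (.inl (.inr i))
  let z : (V → C) → Fin n → C := fun v i => v (.inr (.inl (.inl i)))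
  let t : (V → C) → Fin n → C := fun v i => v (.inr (.inl (.inr i)))
  let r : (V → C) → Fin n → C := fun v i => v (.inr (.inr i))
  have hvar : ∀ f : Fin n → V, A.DefinableMap L (fun (v : V → C) i => v (f i)) :=
    fun f i => Set.DefinableFun.proj L
  have hmul : ∀ f g k : (V → C) → Fin n → C, A.DefinableMap L f → A.DefinableMap L g →
      A.DefinableMap L k →
      A.Definable L {v | 𝒢.mulGraph.Realize (Sum.elim (Sum.elim (f v) (g v)) (k v))} := by
    intro f g k hf hg hk
    refine (definable_realize A 𝒢.mulGraph).preimage_map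
      (F := fun v => Sum.elim (Sum.elim (f v) (g v)) (k v)) ?_
    rintro ((i | i) | i)
    exacts [hf i, hg i, hk i]
  have hdom : ∀ f : (V → C) → Fin n → C, A.DefinableMap L f →
      A.Definable L {v | 𝒢.dom.Realize (f v)} :=
    fun f hf => (definable_realize A 𝒢.dom).preimage_map hf
  have hS : A.Definable L
      ({v | 𝒢.mulGraph.Realize (Sum.elim (Sum.elim c.1 (y v)) (z v))} ∩
        ({v | 𝒢.mulGraph.Realize (Sum.elim (Sum.elim (z v) d.1) (t v))} ∩
        ({v | 𝒢.mulGraph.Realize (Sum.elim (Sum.elim (x v) (r v)) (t v))} ∩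
        ({v | 𝒢.dom.Realize (z v)} ∩ ({v | 𝒢.dom.Realize (t v)} ∩
          ({v | 𝒢.dom.Realize (r v)} ∩ r ⁻¹' T)))))) :=
    (hmul (fun _ => c.1) y z (fun i => definableFun_const L _ (hc i)) (hvar _) (hvar _)).inter <|
    (hmul z (fun _ => d.1) t (hvar _) (fun i => definableFun_const L _ (hd i)) (hvar _)).inter <|
    (hmul x r t (hvar _) (hvar _) (hvar _)).inter <|
    (hdom z (hvar _)).inter <| (hdom t (hvar _)).inter <| (hdom r (hvar _)).inter <|
    hT.preimage_map (hvar _)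
  refine ⟨_, hS.exists_of_finite, fun a b => ⟨fun hab => ?_, ?_⟩⟩
  · refine ⟨Sum.elim (Sum.elim (c * b).1 (c * b * d).1) (a⁻¹ * (c * b * d)).1, ?_, ?_, ?_,
      (c * b).2, (c * b * d).2, (a⁻¹ * (c * b * d)).2, (e _).1 hab⟩
    · exact (mulRel_iff 𝒢 j c b _).2 rfl
    · exact (mulRel_iff 𝒢 j (c * b) d _).2 rfl
    · exact (mulRel_iff 𝒢 j a _ (c * b * d)).2 (mul_inv_cancel_left _ _)
  · rintro ⟨v, h1, h2, h3, h4, h5, h6, h7⟩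
    have h1' := (mulRel_iff 𝒢 j c b ⟨_, h4⟩).1 h1
    have h2' := (mulRel_iff 𝒢 j ⟨_, h4⟩ d ⟨_, h5⟩).1 h2
    have h3' := (mulRel_iff 𝒢 j a ⟨_, h6⟩ ⟨_, h5⟩).1 h3
    change a⁻¹ * (c * b * d) ∈ D
    rw [h1', h2', ← h3', inv_mul_cancel_left]
    exact (e _).2 h7

theorem incl_val_mem_range (g : Pt 𝒢) (i : Fin n) : (incl 𝒢 j g).1 i ∈ Set.range j :=
  ⟨g.1 i, rfl⟩

theorem one_val_mem_range (i : Fin n) : (1 : StarPt 𝒢 j).1 i ∈ Set.range j :=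
  incl_val_mem_range 1 i

theorem IsSaturated.exists_mem_of_filter_star (hC : IsSaturated L C κ) {A : Set C} (hA : #A < κ)
    (W : Filter (StarPt 𝒢 j)) [W.NeBot] :
    ∃ c : StarPt 𝒢 j, ∀ D, IsDefinableOver A D → D ∈ W → c ∈ D := by
  obtain ⟨c, hc⟩ := hC.exists_mem_of_filter hA (W.map StarPt.val)
  have hdom : 𝒢.dom.Realize c :=
    hc _ (definable_realize A 𝒢.dom) (Filter.mem_map.2 (Filter.univ_mem' fun x => x.2))
  refine ⟨⟨c, hdom⟩, fun D hD hDW => ?_⟩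
  obtain ⟨T, hT, e⟩ := hD
  exact (e _).2 (hc T hT (Filter.mem_map.2 (Filter.mem_of_superset hDW fun x hx => (e x).1 hx)))

theorem IsSaturated.exists_mem_of_filter_star₂ (hC : IsSaturated L C κ) {A : Set C} (hA : #A < κ)
    (W : Filter (StarPt 𝒢 j × StarPt 𝒢 j)) [W.NeBot] :
    ∃ c : StarPt 𝒢 j × StarPt 𝒢 j, ∀ D, IsDefinableOver₂ A D → D ∈ W → c ∈ D := by
  obtain ⟨c, hc⟩ := hC.exists_mem_of_filter hA (W.map fun z => Sum.elim z.1.1 z.2.1)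
  have h1 : 𝒢.dom.Realize (c ∘ Sum.inl) :=
    hc _ ((definable_realize A 𝒢.dom).preimage_comp Sum.inl)
      (Filter.mem_map.2 (Filter.univ_mem' fun x => x.1.2))
  have h2 : 𝒢.dom.Realize (c ∘ Sum.inr) :=
    hc _ ((definable_realize A 𝒢.dom).preimage_comp Sum.inr)
      (Filter.mem_map.2 (Filter.univ_mem' fun x => x.2.2))
  refine ⟨(⟨_, h1⟩, ⟨_, h2⟩), fun D hD hDW => ?_⟩
  obtain ⟨T, hT, e⟩ := hD
  refine (e _ _).2 ?_
  rw [Sum.elim_comp_inl_inr]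
  exact hc T hT (Filter.mem_map.2 (Filter.mem_of_superset hDW fun x hx => (e x.1 x.2).1 hx))

theorem IsMonster.mk_range_lt (hC : IsMonster L M C κ) (j : M ↪ₑ[L] C) :
    #(Set.range j) < κ := by
  have h := Cardinal.mk_range_le_lift (f := j)
  exact Cardinal.lift_lt.1 (h.trans_lt hC.card_model_lt)

/-- Tuples are finite and `κ` is infinite, so parameter sets stay small when few tuples are
adjoined. -/
theorem IsMonster.mk_union_coords_lt (hC : IsMonster L M C κ) {A : Set C} (hA : #A < κ)
    {R : Set (StarPt 𝒢 j)} (hR : #R < κ) :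
    #(A ∪ {x | ∃ r ∈ R, ∃ i, r.1 i = x} : Set C) < κ := by
  refine (Cardinal.mk_union_le _ _).trans_lt (Cardinal.add_lt_of_lt hC.aleph0_lt.le hA ?_)
  have h : {x | ∃ r ∈ R, ∃ i, r.1 i = x} ⊆
      Set.range (fun z : R × ULift.{w} (Fin n) => z.1.1.1 z.2.down) := by
    rintro _ ⟨r, hr, i, rfl⟩
    exact ⟨(⟨r, hr⟩, ⟨i⟩), rfl⟩
  refine ((Cardinal.mk_le_mk_of_subset h).trans Cardinal.mk_range_le).trans_lt ?_
  rw [Cardinal.mk_prod, Cardinal.lift_id, Cardinal.lift_id]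
  exact Cardinal.mul_lt_of_lt hC.aleph0_lt.le hR
    ((Cardinal.lt_aleph0_of_finite _).trans hC.aleph0_lt)

/-- Every subset of `G*` definable over `M` that is not empty has a point in `G`. -/
theorem IsDefinableOver.exists_incl_mem {D : Set (StarPt 𝒢 j)}
    (h : IsDefinableOver (Set.range j) D) (hD : D.Nonempty) : ∃ g, incl 𝒢 j g ∈ D := by
  obtain ⟨T, hT, e⟩ := h
  obtain ⟨φ, rfl⟩ := Set.definable_iff_exists_formula_sum.1 hT
  obtain ⟨x, hx⟩ := hD
  -- The parameters are pulled back to `M`, so that the existential statement descends along `j`.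
  choose m hm using fun a : Set.range j => a.2
  let ψ : L.Formula (Set.range j ⊕ Fin n) := φ ⊓ 𝒢.dom.relabel Sum.inr
  have hψ : (ψ.iExs (Fin n)).Realize (j ∘ m) := by
    refine FirstOrder.Language.Formula.realize_iExs.2 ⟨x.1, ?_⟩
    refine FirstOrder.Language.Formula.realize_inf.2 ⟨?_, ?_⟩
    · rw [show j ∘ m = Subtype.val from funext hm]
      exact (e x).1 hx
    · exact FirstOrder.Language.Formula.realize_relabel.2 x.2
  obtain ⟨y, hy⟩ := FirstOrder.Language.Formula.realize_iExs.1 ((j.map_formula _ _).1 hψ)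
  obtain ⟨hy1, hy2⟩ := FirstOrder.Language.Formula.realize_inf.1 hy
  rw [FirstOrder.Language.Formula.realize_relabel] at hy2
  have hy3 : 𝒢.dom.Realize y := hy2
  refine ⟨⟨y, hy3⟩, (e _).2 ?_⟩
  have h2 := (j.map_formula _ _).2 hy1
  change φ.Realize _
  convert h2 using 1
  ext (i | i)
  · exact (hm i).symm
  · rfl

end Saturation

/-! ### The `Δ`-topology on `G*` -/

section DeltaTopology

variable {L : FirstOrder.Language.{u, v}} {M : Type w'} {C : Type w} [L.Structure M]
  [L.Structure C] {n : ℕ} {κ : Cardinal.{w}}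

/-- A copy of `G*` for the topology whose closed sets are the `Δ`-type-definable sets over `M`. -/
def DeltaStar (𝒢 : DefinableGroup L M n) (j : M ↪ₑ[L] C) (_Δ : FormulaSet L n) : Type w :=
  StarPt 𝒢 j

variable {𝒢 : DefinableGroup L M n} {j : M ↪ₑ[L] C} {Δ : FormulaSet L n}

noncomputable instance : Group (DeltaStar 𝒢 j Δ) := inferInstanceAs (Group (StarPt 𝒢 j))

/-- The identity of `G*`, from the topology of type-definable sets to the `Δ`-topology. -/
def toDelta (Δ : FormulaSet L n) (a : StarPt 𝒢 j) : DeltaStar 𝒢 j Δ := a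

/-- The inverse of `toDelta`. -/
def ofDelta (a : DeltaStar 𝒢 j Δ) : StarPt 𝒢 j := a

/-- The inclusion of `G` in `G*` with the `Δ`-topology. -/
noncomputable def inclDelta (𝒢 : DefinableGroup L M n) (j : M ↪ₑ[L] C) (Δ : FormulaSet L n) :
    Pt 𝒢 →* DeltaStar 𝒢 j Δ := inclHom 𝒢 j

instance : TopologicalSpace (DeltaStar 𝒢 j Δ) :=
  TopologicalSpace.generateFrom (deltaSetsStar 𝒢 j Δ : Set (Set (StarPt 𝒢 j)))

theorem isTopologicalBasis_deltaSetsStar :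
    TopologicalSpace.IsTopologicalBasis (α := DeltaStar 𝒢 j Δ)
      (deltaSetsStar 𝒢 j Δ : Set (Set (StarPt 𝒢 j))) where
  exists_subset_inter s hs t ht _ hx :=
    ⟨s ∩ t, BooleanSubalgebra.inf_mem hs ht, hx, subset_rfl⟩
  sUnion_eq := Set.eq_univ_of_univ_subset
    (Set.subset_sUnion_of_mem (BooleanSubalgebra.top_mem (L := deltaSetsStar 𝒢 j Δ)))
  eq_generateFrom := rfl

theorem isOpen_of_mem_deltaSetsStar {D : Set (DeltaStar 𝒢 j Δ)} (hD : D ∈ deltaSetsStar 𝒢 j Δ) :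
    IsOpen D :=
  isTopologicalBasis_deltaSetsStar.isOpen hD

theorem isClosed_of_mem_deltaSetsStar {D : Set (DeltaStar 𝒢 j Δ)}
    (hD : D ∈ deltaSetsStar 𝒢 j Δ) : IsClosed D :=
  isOpen_compl_iff.1 (isOpen_of_mem_deltaSetsStar (BooleanSubalgebra.compl_mem hD))

/-- The basic open sets form a Boolean algebra, hence are clopen, and closed sets are intersections
of basic sets. -/
theorem isClosed_delta_iff {D : Set (DeltaStar 𝒢 j Δ)} :
    IsClosed D ↔ IsDeltaTypeDefinable 𝒢 j Δ D := by
  constructor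
  · intro h
    refine ⟨{s | s ∈ deltaSetsStar 𝒢 j Δ ∧ D ⊆ s}, fun s hs => hs.1, ?_⟩
    refine Set.Subset.antisymm (Set.subset_sInter fun s hs => hs.2) fun x hx => ?_
    by_contra hxD
    obtain ⟨E, hE, hxE, hED⟩ :=
      isTopologicalBasis_deltaSetsStar.exists_subset_of_mem_open (u := Dᶜ) hxD h.isOpen_compl
    exact hx Eᶜ ⟨BooleanSubalgebra.compl_mem hE, Set.subset_compl_comm.1 hED⟩ hxE
  · rintro ⟨S, hS, rfl⟩
    exact isClosed_sInter fun s hs => isClosed_of_mem_deltaSetsStar (hS s hs)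

theorem isDeltaDefinableStarMap_iff {X : Type*} [TopologicalSpace X] {f : StarPt 𝒢 j → X} :
    IsDeltaDefinableStarMap 𝒢 j Δ f ↔ Continuous fun a : DeltaStar 𝒢 j Δ => f (ofDelta a) := by
  rw [continuous_iff_isClosed]
  exact forall₂_congr fun s _ => isClosed_delta_iff.symm

theorem realize_star_incl (ψ : Σ k : ℕ, L.Formula (Fin n ⊕ Fin k)) (a b g : Pt 𝒢)
    (c : Fin ψ.1 → M) :
    ψ.2.Realize (Sum.elim (incl 𝒢 j a * incl 𝒢 j g * incl 𝒢 j b).1 (j ∘ c)) ↔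
      ψ.2.Realize (Sum.elim (a * g * b).1 c) := by
  rw [← incl_mul', ← incl_mul', ← j.map_formula ψ.2]
  apply iff_of_eq
  congr 1
  ext (i | i) <;> rfl

theorem preimage_incl_mem_deltaSets {D : Set (StarPt 𝒢 j)} (hD : D ∈ deltaSetsStar 𝒢 j Δ) :
    incl 𝒢 j ⁻¹' D ∈ deltaSets 𝒢 Δ := by
  refine BooleanSubalgebra.closure_bot_sup_induction
    (p := fun D _ => incl 𝒢 j ⁻¹' D ∈ deltaSets 𝒢 Δ) ?_ ?_ ?_ ?_ hD
  · rintro _ ⟨ψ, hψ, a, b, c, rfl⟩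
    refine BooleanSubalgebra.subset_closure ⟨ψ, hψ, a, b, c, ?_⟩
    ext g
    exact realize_star_incl ψ a b g c
  · exact BooleanSubalgebra.bot_mem
  · intro x _ y _ hx hy
    exact BooleanSubalgebra.sup_mem hx hy
  · intro x _ hx
    exact BooleanSubalgebra.compl_mem hx

theorem exists_preimage_incl_eq (j : M ↪ₑ[L] C) {D : Set (Pt 𝒢)} (hD : D ∈ deltaSets 𝒢 Δ) :
    ∃ E ∈ deltaSetsStar 𝒢 j Δ, incl 𝒢 j ⁻¹' E = D := by
  refine BooleanSubalgebra.closure_bot_sup_induction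
    (p := fun D _ => ∃ E ∈ deltaSetsStar 𝒢 j Δ, incl 𝒢 j ⁻¹' E = D) ?_ ?_ ?_ ?_ hD
  · rintro _ ⟨ψ, hψ, a, b, c, rfl⟩
    refine ⟨_, BooleanSubalgebra.subset_closure ⟨ψ, hψ, a, b, c, rfl⟩, ?_⟩
    ext g
    exact realize_star_incl ψ a b g c
  · exact ⟨∅, BooleanSubalgebra.bot_mem, rfl⟩
  · rintro _ _ _ _ ⟨E, hE, rfl⟩ ⟨F, hF, rfl⟩
    exact ⟨E ∪ F, BooleanSubalgebra.sup_mem hE hF, rfl⟩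
  · rintro _ _ ⟨E, hE, rfl⟩
    exact ⟨Eᶜ, BooleanSubalgebra.compl_mem hE, rfl⟩

theorem isDefinableOver_of_mem_deltaSetsStar {D : Set (StarPt 𝒢 j)}
    (hD : D ∈ deltaSetsStar 𝒢 j Δ) : IsDefinableOver (Set.range j) D := by
  refine BooleanSubalgebra.closure_bot_sup_induction
    (p := fun D _ => IsDefinableOver (Set.range j) D) ?_ ?_ ?_ ?_ hD
  · rintro _ ⟨ψ, hψ, a, b, c, rfl⟩
    have h0 : IsDefinableOver (Set.range j)
        {g : StarPt 𝒢 j | ψ.2.Realize (Sum.elim g.1 (j ∘ c))} := by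
      refine ⟨(fun x => Sum.elim x (j ∘ c)) ⁻¹' {v | ψ.2.Realize v},
        (definable_realize _ ψ.2).preimage_map ?_, fun _ => Iff.rfl⟩
      rintro (i | i)
      · exact Set.DefinableFun.proj L
      · exact FirstOrder.Language.definableFun_const L _ ⟨c i, rfl⟩
    have h1 := (h0.inv_mul (incl 𝒢 j a) (incl 𝒢 j b) (incl_val_mem_range a)
      (incl_val_mem_range b)).left_slice 1 one_val_mem_range
    simpa using h1
  · exact isDefinableOver_empty _
  · intro x _ y _ hx hy
    exact hx.union hy
  · intro x _ hx
    exact hx.compl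

/-! ### Compactness of the two topologies and density of $G$ -/

theorem isClosed_star_iff {D : Set (StarPt 𝒢 j)} : IsClosed D ↔ IsTypeDefinable 𝒢 j D := by
  rw [← isOpen_compl_iff]
  change Dᶜᶜ ∈ {D | IsTypeDefinable 𝒢 j D} ↔ _
  rw [compl_compl, Set.mem_ofPred_eq]

theorem isTypeDefinable_iff {D : Set (StarPt 𝒢 j)} : IsTypeDefinable 𝒢 j D ↔
    ∃ S : Set (Set (StarPt 𝒢 j)), (∀ s ∈ S, IsDefinableOver (Set.range j) s) ∧ D = ⋂₀ S := by
  constructor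
  · rintro ⟨S, hS, rfl⟩
    refine ⟨(fun s => {g : StarPt 𝒢 j | g.1 ∈ s}) '' S, ?_, ?_⟩
    · rintro _ ⟨s, hs, rfl⟩
      exact ⟨s, hS s hs, fun _ => Iff.rfl⟩
    · ext g
      simp
  · rintro ⟨S, hS, rfl⟩
    refine ⟨{T | (Set.range j).Definable L T ∧ {g : StarPt 𝒢 j | g.1 ∈ T} ∈ S},
      fun s hs => hs.1, ?_⟩
    ext g
    simp only [Set.mem_sInter, Set.mem_ofPred_eq]
    constructor
    · intro h s hs
      exact h _ hs.2
    · intro h s hs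
      obtain ⟨T, hT, e⟩ := hS s hs
      have hs' : s = {g : StarPt 𝒢 j | g.1 ∈ T} := Set.ext e
      exact (e g).2 (h T ⟨hT, hs' ▸ hs⟩)

theorem isOpen_of_isDefinableOver {D : Set (StarPt 𝒢 j)}
    (hD : IsDefinableOver (Set.range j) D) : IsOpen D := by
  rw [← isClosed_compl_iff, isClosed_star_iff, isTypeDefinable_iff]
  exact ⟨{Dᶜ}, by simpa using hD.compl, by simp⟩

theorem continuous_toDelta : Continuous (toDelta (𝒢 := 𝒢) (j := j) Δ) :=
  continuous_generateFrom_iff.2 fun _ hs =>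
    isOpen_of_isDefinableOver (isDefinableOver_of_mem_deltaSetsStar hs)

/-- An ultrafilter converges to any realization of the type over `M` that it determines. -/
theorem IsMonster.compactSpace_star (hC : IsMonster L M C κ) : CompactSpace (StarPt 𝒢 j) := by
  refine ⟨isCompact_iff_ultrafilter_le_nhds.2 fun W _ => ?_⟩
  obtain ⟨c, hc⟩ := hC.saturated.exists_mem_of_filter_star (hC.mk_range_lt j)
    (W : Filter (StarPt 𝒢 j))
  refine ⟨c, Set.mem_univ c, fun O hO => ?_⟩
  obtain ⟨V, hVO, hV, hcV⟩ := mem_nhds_iff.1 hO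
  obtain ⟨S, hS, e⟩ := isTypeDefinable_iff.1 (isClosed_star_iff.1 hV.isClosed_compl)
  have hcS : c ∉ ⋂₀ S := by
    rw [← e]
    exact fun h => h hcV
  rw [Set.mem_sInter] at hcS
  push Not at hcS
  obtain ⟨s, hs, hcs⟩ := hcS
  have hsW : sᶜ ∈ (W : Filter (StarPt 𝒢 j)) :=
    Ultrafilter.compl_mem_iff_notMem.2 fun h => hcs (hc s (hS s hs) h)
  refine Filter.mem_of_superset hsW ((Set.compl_subset_comm.1 ?_).trans hVO)
  rw [e]
  exact Set.sInter_subset_of_mem hs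

theorem IsMonster.compactSpace_delta (hC : IsMonster L M C κ) :
    CompactSpace (DeltaStar 𝒢 j Δ) :=
  have := hC.compactSpace_star (𝒢 := 𝒢) (j := j)
  Function.Surjective.compactSpace (f := toDelta Δ) continuous_toDelta fun a => ⟨a, rfl⟩

theorem denseRange_inclDelta : DenseRange (inclDelta 𝒢 j Δ) := by
  refine isTopologicalBasis_deltaSetsStar.dense_iff.2 fun D hD hne => ?_
  obtain ⟨g, hg⟩ := (isDefinableOver_of_mem_deltaSetsStar hD).exists_incl_mem hne
  exact ⟨_, hg, g, rfl⟩

theorem continuous_inclDelta_mul (g : Pt 𝒢) :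
    Continuous fun a : DeltaStar 𝒢 j Δ => inclDelta 𝒢 j Δ g * a :=
  continuous_generateFrom_iff.2 fun _ hs =>
    isOpen_of_mem_deltaSetsStar (translate_mem 𝒢 j Δ g _ hs)

/-- This is what the right-hand variable `z` in the formulas `ψ(y * x * z; t)` provides. -/
theorem continuous_mul_inclDelta (g : Pt 𝒢) :
    Continuous fun a : DeltaStar 𝒢 j Δ => a * inclDelta 𝒢 j Δ g := by
  refine continuous_generateFrom_iff.2 fun D hD => isOpen_of_mem_deltaSetsStar ?_
  refine BooleanSubalgebra.closure_bot_sup_induction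
    (p := fun D _ => (fun a => a * incl 𝒢 j g) ⁻¹' D ∈ deltaSetsStar 𝒢 j Δ)
    ?_ ?_ ?_ ?_ hD
  · rintro _ ⟨ψ, hψ, a, b, c, rfl⟩
    refine BooleanSubalgebra.subset_closure ⟨ψ, hψ, a, g * b, c, ?_⟩
    ext x
    simp only [Set.mem_preimage, Set.mem_ofPred_eq, incl_mul', mul_assoc]
  · exact BooleanSubalgebra.bot_mem
  · intro x _ y _ hx hy
    exact BooleanSubalgebra.sup_mem hx hy
  · intro x _ hx
    exact BooleanSubalgebra.compl_mem hx

/-- A map with a continuous extension to `G*` is `Δ`-definable. -/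
theorem isDeltaDefinableMap_of_extension [CompactSpace (DeltaStar 𝒢 j Δ)] {X : Type*}
    [TopologicalSpace X] {f : Pt 𝒢 → X} {F : DeltaStar 𝒢 j Δ → X} (hF : Continuous F)
    (hFf : ∀ g, F (inclDelta 𝒢 j Δ g) = f g) : IsDeltaDefinableMap 𝒢 Δ f := by
  intro C₁ C₂ h₁ h₂ hd
  obtain ⟨S, hS, e⟩ := isClosed_delta_iff.1 (h₁.preimage hF)
  -- By compactness, finitely many of the sets whose intersection is the preimage of `C₁` already
  -- miss the preimage of `C₂`; the trace of their intersection on `G` separates.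
  obtain ⟨t, ht⟩ := (h₂.preimage hF).isCompact.elim_finite_subfamily_closed
    (fun s : S => ofDelta ⁻¹' s.1)
    (fun s => isClosed_of_mem_deltaSetsStar (hS _ s.2)) (by
      rw [← Set.preimage_iInter, ← Set.sInter_eq_iInter]
      have e' : ofDelta ⁻¹' ⋂₀ S = F ⁻¹' C₁ := e.symm
      rw [e', Set.inter_comm]
      exact (hd.preimage F).inter_eq)
  have hmem : (⋂ s ∈ t, (s : Set (StarPt 𝒢 j))) ∈ deltaSetsStar 𝒢 j Δ := by
    clear ht
    induction t using Finset.cons_induction with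
    | empty =>
      simpa using BooleanSubalgebra.top_mem (L := deltaSetsStar 𝒢 j Δ)
    | cons s t hs ih =>
      simpa using BooleanSubalgebra.inf_mem (hS _ s.2) ih
  refine ⟨_, preimage_incl_mem_deltaSets hmem, fun g hg => ?_, ?_⟩
  · refine Set.mem_iInter₂.2 fun s _ => ?_
    have hg' : inclDelta 𝒢 j Δ g ∈ F ⁻¹' C₁ := by
      rw [Set.mem_preimage, hFf]
      exact hg
    rw [e] at hg'
    exact hg' _ s.2
  · rw [Set.disjoint_left]
    intro g hg hg2
    have : inclDelta 𝒢 j Δ g ∈ F ⁻¹' C₂ ∩ ⋂ s ∈ t, ofDelta ⁻¹' s.1 := by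
      refine ⟨?_, Set.mem_iInter₂.2 fun s hs => Set.mem_iInter₂.1 hg s hs⟩
      rw [Set.mem_preimage, hFf]
      exact hg2
    rw [ht] at this
    exact this

/-- A `Δ`-definable map to a compact Hausdorff space has a continuous extension to `G*`. -/
theorem IsDeltaDefinableMap.exists_extension (j : M ↪ₑ[L] C) {X : Type*} [TopologicalSpace X]
    [CompactSpace X] [T2Space X] {f : Pt 𝒢 → X} (hf : IsDeltaDefinableMap 𝒢 Δ f) :
    ∃ F : DeltaStar 𝒢 j Δ → X, Continuous F ∧ ∀ g, F (inclDelta 𝒢 j Δ g) = f g := by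
  let _ : TopologicalSpace (Pt 𝒢) := TopologicalSpace.induced (inclDelta 𝒢 j Δ) inferInstance
  have di : IsDenseInducing (inclDelta 𝒢 j Δ) := ⟨⟨rfl⟩, denseRange_inclDelta⟩
  have hlim : ∀ b : DeltaStar 𝒢 j Δ, ∃ c, Tendsto f (comap (inclDelta 𝒢 j Δ) (𝓝 b)) (𝓝 c) := by
    intro b
    have := di.comap_nhds_neBot b
    -- A cluster point is the limit: a clopen `E` separating a closed neighbourhood `V` of `c` from
    -- the complement of `W` must contain `b`, as otherwise the values near `b` would avoid `V`.
    obtain ⟨c, -, hc⟩ := (isCompact_univ (X := X)).exists_clusterPt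
      (f := map f (comap (inclDelta 𝒢 j Δ) (𝓝 b))) (by simp)
    refine ⟨c, fun W hW => ?_⟩
    obtain ⟨V, ⟨hV, hVc⟩, hVW⟩ :=
      (closed_nhds_basis c).mem_iff.1 (interior_mem_nhds.2 hW)
    obtain ⟨D, hD, hVD, hDW⟩ := hf V (interior W)ᶜ hVc isOpen_interior.isClosed_compl
      (Set.disjoint_compl_right_iff_subset.2 hVW)
    obtain ⟨E, hE, rfl⟩ := exists_preimage_incl_eq j hD
    have hE' := isOpen_of_mem_deltaSetsStar hE
    by_cases hbE : b ∈ E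
    · refine mem_map.2 (Filter.mem_of_superset (preimage_mem_comap (hE'.mem_nhds hbE)) ?_)
      intro g hg
      by_contra hgW
      exact Set.disjoint_left.1 hDW hg fun h => hgW (interior_subset (s := W) h)
    · exfalso
      have hEc := preimage_mem_comap (m := inclDelta 𝒢 j Δ)
        ((isClosed_of_mem_deltaSetsStar hE).isOpen_compl.mem_nhds hbE)
      have hVc' : Vᶜ ∈ map f (comap (inclDelta 𝒢 j Δ) (𝓝 b)) :=
        mem_map.2 (Filter.mem_of_superset hEc fun g hg hgV => hg (hVD hgV))
      obtain ⟨x, hx, hx'⟩ := (clusterPt_iff_nonempty.1 hc) hV hVc'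
      exact hx' hx
  refine ⟨di.extend f, di.continuous_extend hlim, fun g => ?_⟩
  obtain ⟨c, hc⟩ := hlim (inclDelta 𝒢 j Δ g)
  rw [di.extend_eq_of_tendsto hc]
  have hp : pure g ≤ comap (inclDelta 𝒢 j Δ) (𝓝 (inclDelta 𝒢 j Δ g)) := by
    rw [← map_le_iff_le_comap, Filter.map_pure]
    exact pure_le_nhds _
  exact tendsto_nhds_unique (hc.mono_left hp) (tendsto_pure_nhds f g)

end DeltaTopology

/-! ### The universal ambit of a dense subgroup of a compact space -/

section OrbitFunctions

variable {G K : Type*} [Group G] [Group K] [TopologicalSpace K]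

/-- The continuous functions `φ : K → [0, 1]` such that all the functions `g ↦ φ (g a)` on `G`
extend continuously to `K`. -/
def orbitFunctions (i : G →* K) : Set (K → unitInterval) :=
  {φ | Continuous φ ∧ ∀ a, ∃ F : K → unitInterval, Continuous F ∧ ∀ g, F (i g) = φ (i g * a)}

/-- The evaluation map from `K` to the product of copies of `[0, 1]` indexed by the orbit
functions. -/
def orbitEval (i : G →* K) (a : K) (φ : orbitFunctions i) : unitInterval := φ.1 a

variable {i : G →* K}

theorem continuous_orbitEval : Continuous (orbitEval i) :=
  continuous_pi fun φ => φ.2.1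

/-- The orbit function `a ↦ φ (g a)`. -/
def translateFunction (hl : ∀ g, Continuous fun a : K => i g * a) (g : G) (φ : orbitFunctions i) :
    orbitFunctions i :=
  ⟨fun a => φ.1 (i g * a), φ.2.1.comp (hl g), fun a => by
    obtain ⟨F, hF, h⟩ := φ.2.2 a
    refine ⟨fun b => F (i g * b), hF.comp (hl g), fun k => ?_⟩
    change F (i g * i k) = φ.1 (i g * (i k * a))
    rw [← map_mul, h, map_mul, mul_assoc]⟩

/-- The action of `G` on the image of the evaluation map. -/
@[reducible]
def orbitEvalAction (hl : ∀ g, Continuous fun a : K => i g * a) :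
    MulAction G (Set.range (orbitEval i)) where
  smul g x := ⟨fun φ => x.1 (translateFunction hl g φ), by
    obtain ⟨_, a, rfl⟩ := x
    exact ⟨i g * a, rfl⟩⟩
  one_smul := by
    rintro ⟨_, a, rfl⟩
    refine Subtype.ext (funext fun φ => congrArg φ.1 ?_)
    rw [map_one, one_mul]
  mul_smul := by
    rintro g h ⟨_, a, rfl⟩
    refine Subtype.ext (funext fun φ => congrArg φ.1 ?_)
    change i (g * h) * a = i g * (i h * a)
    rw [map_mul, mul_assoc]

/-- The extensions of the coordinates assemble to a continuous map into the cube. It sends `G` into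
the image of the evaluation, which is compact and hence closed, so by density it sends all of `K`
there. -/
theorem exists_extension_orbitEval [CompactSpace K] (hd : DenseRange i) (a : K) :
    ∃ F : K → Set.range (orbitEval i), Continuous F ∧
      ∀ g, F (i g) = Set.rangeFactorization (orbitEval i) (i g * a) := by
  choose F hF h using fun φ : orbitFunctions i => φ.2.2 a
  have hcont : Continuous fun b φ => F φ b := continuous_pi hF
  have hmem : ∀ b, (fun φ => F φ b) ∈ Set.range (orbitEval i) := by
    refine fun b => hd.induction_on b
      ((isCompact_range continuous_orbitEval).isClosed.preimage hcont) fun g => ?_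
    exact ⟨i g * a, funext fun φ => (h φ g).symm⟩
  exact ⟨fun b => ⟨_, hmem b⟩, hcont.subtype_mk hmem, fun g => Subtype.ext (funext fun φ => h φ g)⟩

/-- Two points on which all orbit functions agree are not distinguished by the extension to `K` of
an orbit map of a `G`-space all of whose orbit maps extend to `K`. -/
theorem eq_of_orbitEval_eq (hd : DenseRange i) (hl : ∀ g, Continuous fun a : K => i g * a)
    {X : Type*} [TopologicalSpace X] [CompactSpace X] [T2Space X] [MulAction G X]
    (hs : ∀ g : G, Continuous fun y : X => g • y)
    (hX : ∀ y : X, ∃ F : K → X, Continuous F ∧ ∀ g, F (i g) = g • y)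
    {f : K → X} (hf : Continuous f) {x : X} (hfx : ∀ g, f (i g) = g • x) {a b : K}
    (hab : orbitEval i a = orbitEval i b) : f a = f b := by
  -- Equivariance holds on the dense subgroup and extends because `X` is Hausdorff.
  have hmul : ∀ g c, f (i g * c) = g • f c := by
    intro g c
    have h := hd.equalizer (hf.comp (hl g)) ((hs g).comp hf) (funext fun k => by
      simp only [Function.comp_apply]
      rw [← map_mul, hfx, hfx, mul_smul])
    exact congrFun h c
  by_contra hne
  obtain ⟨φ, h0, h1, h01⟩ := exists_continuous_zero_one_of_isClosed
    (isClosed_singleton (x := f a)) (isClosed_singleton (x := f b))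
    (Set.disjoint_singleton.2 hne)
  let ψ : X → unitInterval := fun y => ⟨φ y, h01 y⟩
  have hψ : Continuous ψ := φ.continuous.subtype_mk _
  -- By equivariance `ψ (f (g c)) = ψ (g • f c)`, so the extension of the orbit map of `f c`
  -- composed with `ψ` is the required one.
  have hmem : ψ ∘ f ∈ orbitFunctions i := by
    refine ⟨hψ.comp hf, fun c => ?_⟩
    obtain ⟨F, hF, h⟩ := hX (f c)
    exact ⟨ψ ∘ F, hψ.comp hF, fun g => by
      rw [Function.comp_apply, Function.comp_apply, h, hmul]⟩
  have h : φ (f a) = φ (f b) := congrArg Subtype.val (congrFun hab ⟨ψ ∘ f, hmem⟩)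
  rw [h0 rfl, h1 rfl] at h
  exact zero_ne_one h

end OrbitFunctions

/-! ### The universal `Δ`-definable ambit -/

section Universal

variable {L : FirstOrder.Language.{u, v}} {M : Type w'} {C : Type w} [L.Structure M]
  [L.Structure C] {n : ℕ} {𝒢 : DefinableGroup L M n} {j : M ↪ₑ[L] C} {Δ : FormulaSet L n}

/-- The class `a/E'_Δ` of a point of `G*` with the `Δ`-topology. -/
def deltaToUniv (𝒢 : DefinableGroup L M n) (j : M ↪ₑ[L] C) (Δ : FormulaSet L n)
    (a : DeltaStar 𝒢 j Δ) : Univ 𝒢 j Δ :=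
  toUniv 𝒢 j Δ (ofDelta a)

theorem deltaToUniv_surjective : Function.Surjective (deltaToUniv 𝒢 j Δ) :=
  Quotient.mk_surjective

theorem toUniv_incl_eq (g : Pt 𝒢) :
    toUniv 𝒢 j Δ (incl 𝒢 j g) = g • toUniv 𝒢 j Δ 1 := by
  change _ = toUniv 𝒢 j Δ (incl 𝒢 j g * 1)
  rw [mul_one]

/-- The image of the evaluation map is itself a `Δ`-definable ambit in the universe of `C`, with
base point the image of `1`, so it is among the ambits tested by `ambitRel`. -/
theorem orbitEval_eq_of_ambitRel [CompactSpace (DeltaStar 𝒢 j Δ)] {a b : DeltaStar 𝒢 j Δ}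
    (h : ambitRel 𝒢 j Δ (ofDelta a) (ofDelta b)) :
    orbitEval (inclDelta 𝒢 j Δ) a = orbitEval (inclDelta 𝒢 j Δ) b := by
  let _ := orbitEvalAction (i := inclDelta 𝒢 j Δ) continuous_inclDelta_mul
  let ev := Set.rangeFactorization (orbitEval (inclDelta 𝒢 j Δ))
  have hev : Continuous ev := continuous_orbitEval.subtype_mk _
  have hsmul : ∀ (g : Pt 𝒢) c, g • ev c = ev (inclDelta 𝒢 j Δ g * c) := fun _ _ => rfl
  have hamb : IsDeltaAmbit 𝒢 Δ (Set.range (orbitEval (inclDelta 𝒢 j Δ))) (ev 1) := by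
    refine ⟨isCompact_iff_compactSpace.1 (isCompact_range continuous_orbitEval), inferInstance,
      fun g => ?_, ?_, ?_⟩
    · refine Continuous.subtype_mk (continuous_pi fun φ => ?_) _
      exact (continuous_apply (translateFunction continuous_inclDelta_mul g φ)).comp
        continuous_subtype_val
    · rintro ⟨_, c, rfl⟩
      obtain ⟨F, hF, hFc⟩ := exists_extension_orbitEval (i := inclDelta 𝒢 j Δ)
        denseRange_inclDelta c
      exact isDeltaDefinableMap_of_extension hF fun g => hFc g
    · have hd := (Set.rangeFactorization_surjective
        (f := orbitEval (inclDelta 𝒢 j Δ))).denseRange.comp denseRange_inclDelta hev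
      have e : (fun g : Pt 𝒢 => g • ev 1) = ev ∘ inclDelta 𝒢 j Δ := funext fun g => by
        rw [hsmul, mul_one]
        rfl
      rw [e]
      exact hd
  have := h _ (ev 1) hamb (fun c => ev (toDelta Δ c)) (isDeltaDefinableStarMap_iff.2 hev)
    (fun g => by
      rw [hsmul, mul_one]
      rfl)
  exact congrArg Subtype.val this

theorem ambitRel_of_orbitEval_eq {a b : DeltaStar 𝒢 j Δ}
    (h : orbitEval (inclDelta 𝒢 j Δ) a = orbitEval (inclDelta 𝒢 j Δ) b) :
    ambitRel 𝒢 j Δ (ofDelta a) (ofDelta b) := by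
  intro X _ _ x hx f hf hfx
  have := hx.compact
  have := hx.hausdorff
  exact eq_of_orbitEval_eq denseRange_inclDelta continuous_inclDelta_mul hx.continuous_smul
    (fun y => (hx.definable y).exists_extension j) (isDeltaDefinableStarMap_iff.1 hf) hfx h

/-- The injection of the universal ambit in a product of copies of `[0, 1]`. -/
noncomputable def univEval [CompactSpace (DeltaStar 𝒢 j Δ)] :
    Univ 𝒢 j Δ → orbitFunctions (inclDelta 𝒢 j Δ) → unitInterval :=
  Quotient.lift (fun a => orbitEval (inclDelta 𝒢 j Δ) (toDelta Δ a))
    fun _ _ h => orbitEval_eq_of_ambitRel h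

variable [CompactSpace (DeltaStar 𝒢 j Δ)]

theorem continuous_univEval : Continuous (univEval (𝒢 := 𝒢) (j := j) (Δ := Δ)) :=
  Continuous.quotient_lift (continuous_orbitEval.comp continuous_toDelta) _

theorem univEval_injective : Function.Injective (univEval (𝒢 := 𝒢) (j := j) (Δ := Δ)) := by
  rintro ⟨a⟩ ⟨b⟩ h
  exact Quotient.sound (ambitRel_of_orbitEval_eq h)

instance : T2Space (Univ 𝒢 j Δ) :=
  T2Space.of_injective_continuous univEval_injective continuous_univEval

variable [CompactSpace (StarPt 𝒢 j)]

theorem isClosedEmbedding_univEval :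
    IsClosedEmbedding (univEval (𝒢 := 𝒢) (j := j) (Δ := Δ)) :=
  continuous_univEval.isClosedEmbedding univEval_injective

theorem continuous_deltaToUniv : Continuous (deltaToUniv 𝒢 j Δ) :=
  isClosedEmbedding_univEval.continuous_iff.2 continuous_orbitEval

/-- The logic topology is thus also the quotient of the coarser `Δ`-topology, for which translations
by `G` are known to be continuous. -/
theorem isQuotientMap_deltaToUniv : IsQuotientMap (deltaToUniv 𝒢 j Δ) := by
  refine isQuotientMap_iff_isClosed.2 ⟨deltaToUniv_surjective, fun s =>
    ⟨fun h => h.preimage continuous_deltaToUniv, fun h => ?_⟩⟩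
  exact isQuotientMap_quot_mk.isClosed_preimage.1 (h.preimage continuous_toDelta)

theorem continuous_smul_univ (g : Pt 𝒢) : Continuous fun p : Univ 𝒢 j Δ => g • p :=
  isQuotientMap_deltaToUniv.continuous_iff.2
    (continuous_deltaToUniv.comp (continuous_inclDelta_mul g))

/-! ### The semigroup operation on the universal ambit -/

/-- The orbit map `g ↦ g q` extends continuously to `G*`. -/
theorem exists_extension_smul_univ (q : Univ 𝒢 j Δ) :
    ∃ F : DeltaStar 𝒢 j Δ → Univ 𝒢 j Δ, Continuous F ∧ ∀ g, F (inclDelta 𝒢 j Δ g) = g • q := by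
  obtain ⟨a, rfl⟩ := deltaToUniv_surjective q
  obtain ⟨F, hF, hFa⟩ := exists_extension_orbitEval (i := inclDelta 𝒢 j Δ)
    denseRange_inclDelta a
  have hmem : ∀ b, ∃ p, univEval p = (F b).1 := by
    intro b
    obtain ⟨c, hc⟩ := (F b).2
    exact ⟨deltaToUniv 𝒢 j Δ c, hc⟩
  choose F' hF' using hmem
  refine ⟨F', isClosedEmbedding_univEval.continuous_iff.2 ?_, fun g => univEval_injective ?_⟩
  · rw [show univEval ∘ F' = fun b => (F b).1 from funext hF']
    exact continuous_subtype_val.comp hF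
  · rw [hF', hFa]
    rfl

theorem exists_continuous_extension_univ (q : Univ 𝒢 j Δ) :
    ∃ r : Univ 𝒢 j Δ → Univ 𝒢 j Δ, Continuous r ∧
      ∀ g, r (toUniv 𝒢 j Δ (incl 𝒢 j g)) = g • q := by
  obtain ⟨F, hF, hFq⟩ := exists_extension_smul_univ q
  refine ⟨Quotient.lift (fun a => F (toDelta Δ a)) fun a b h => ?_, ?_, hFq⟩
  -- The extension descends to the quotient: the quotient itself serves as the `G`-space whose orbit
  -- maps extend.
  · exact eq_of_orbitEval_eq denseRange_inclDelta continuous_inclDelta_mul continuous_smul_univ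
      exists_extension_smul_univ hF hFq (orbitEval_eq_of_ambitRel h)
  · exact isQuotientMap_deltaToUniv.continuous_iff.2 hF

theorem denseRange_toUniv_incl : DenseRange fun g : Pt 𝒢 => toUniv 𝒢 j Δ (incl 𝒢 j g) :=
  deltaToUniv_surjective.denseRange.comp denseRange_inclDelta continuous_deltaToUniv

theorem comap_toUniv_incl_neBot (p : Univ 𝒢 j Δ) :
    (comap (fun g : Pt 𝒢 => toUniv 𝒢 j Δ (incl 𝒢 j g)) (𝓝 p)).NeBot :=
  comap_neBot_iff.2 fun _ ht =>
    let ⟨_, hx, g, hg⟩ := mem_closure_iff_nhds.1 (denseRange_toUniv_incl p) _ ht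
    ⟨g, by simpa only [hg] using hx⟩

/-- The limits defining the semigroup operation exist. -/
theorem tendsto_smul_mul (p q : Univ 𝒢 j Δ) :
    Tendsto (fun g : Pt 𝒢 => g • q)
      (comap (fun g : Pt 𝒢 => toUniv 𝒢 j Δ (incl 𝒢 j g)) (𝓝 p)) (𝓝 (p * q)) := by
  obtain ⟨r, hr, hrq⟩ := exists_continuous_extension_univ q
  refine tendsto_nhds_limUnder ⟨r p, ?_⟩
  simp only [← hrq]
  exact (hr.tendsto p).comp tendsto_comap

theorem toUniv_incl_mul (g : Pt 𝒢) (q : Univ 𝒢 j Δ) :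
    toUniv 𝒢 j Δ (incl 𝒢 j g) * q = g • q := by
  have hp : pure g ≤ comap (fun g : Pt 𝒢 => toUniv 𝒢 j Δ (incl 𝒢 j g))
      (𝓝 (toUniv 𝒢 j Δ (incl 𝒢 j g))) := by
    rw [← map_le_iff_le_comap, Filter.map_pure]
    exact pure_le_nhds _
  exact tendsto_nhds_unique ((tendsto_smul_mul _ q).mono_left hp) (tendsto_pure_nhds _ g)

theorem continuous_mul_univ (q : Univ 𝒢 j Δ) : Continuous fun p : Univ 𝒢 j Δ => p * q := by
  obtain ⟨r, hr, hrq⟩ := exists_continuous_extension_univ q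
  have : (fun p : Univ 𝒢 j Δ => p * q) = r := by
    funext p
    have := comap_toUniv_incl_neBot p
    refine tendsto_nhds_unique (tendsto_smul_mul p q) ?_
    simp only [← hrq]
    exact (hr.tendsto p).comp tendsto_comap
  rwa [this]

theorem smul_mul_univ (g : Pt 𝒢) (p q : Univ 𝒢 j Δ) : g • p * q = g • (p * q) := by
  refine congrFun (denseRange_toUniv_incl.equalizer
    ((continuous_mul_univ q).comp (continuous_smul_univ g))
    ((continuous_smul_univ g).comp (continuous_mul_univ q)) (funext fun h => ?_)) p
  simp only [Function.comp_apply]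
  rw [toUniv_incl_mul, toUniv_incl_eq, ← mul_smul, ← toUniv_incl_eq, toUniv_incl_mul, mul_smul]

theorem mul_assoc_univ (p q r : Univ 𝒢 j Δ) : p * q * r = p * (q * r) := by
  refine congrFun (denseRange_toUniv_incl.equalizer
    ((continuous_mul_univ r).comp (continuous_mul_univ q)) (continuous_mul_univ (q * r))
    (funext fun g => ?_)) p
  simp only [Function.comp_apply]
  rw [toUniv_incl_mul, toUniv_incl_mul, smul_mul_univ]

end Universal

/-! ### The points of a semitopological group that are not separated from the identity -/

section Semitopological

variable {E : Type*} [Group E] [TopologicalSpace E]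

/-- In a group with separately continuous multiplication, the points not separated from the
identity by open sets form a subgroup. -/
def nonseparatedSubgroup (hl : ∀ b : E, Continuous fun x => b * x)
    (hr : ∀ b : E, Continuous fun x => x * b) : Subgroup E where
  carrier := {x | ∀ V ∈ 𝓝 (1 : E), x ∈ closure V}
  one_mem' := fun _ hV => subset_closure (mem_of_mem_nhds hV)
  mul_mem' := by
    intro x y hx hy V hV
    obtain ⟨V', hV'V, hV', h1⟩ := mem_nhds_iff.1 hV
    refine closure_mono hV'V (mem_closure_iff.2 fun W hW hxy => ?_)
    -- First `x` is replaced by a nearby `a ∈ V'` with `a * y ∈ W`, then `y` by `t` near the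
    -- identity with `a * t ∈ V' ∩ W`; only one factor moves at a time.
    obtain ⟨a, haW, haV⟩ := mem_closure_iff.1 (hx V' (hV'.mem_nhds h1)) _ (hW.preimage (hr y)) hxy
    have ha : {t | a * t ∈ V'} ∈ 𝓝 (1 : E) :=
      (hV'.preimage (hl a)).mem_nhds (by simpa using haV)
    obtain ⟨t, htW, htV⟩ := mem_closure_iff.1 (hy _ ha) _ (hW.preimage (hl a)) haW
    exact ⟨a * t, htW, htV⟩
  inv_mem' := by
    intro x hx V hV
    refine mem_closure_iff.2 fun W hW hxW => ?_
    obtain ⟨V', hV'V, hV', h1⟩ := mem_nhds_iff.1 hV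
    have hW1 : {t | x⁻¹ * t ∈ W} ∈ 𝓝 (1 : E) :=
      (hW.preimage (hl x⁻¹)).mem_nhds (by simpa using hxW)
    obtain ⟨t, ht, htW⟩ := mem_closure_iff.1 (hx _ hW1) _ (hV'.preimage (hl x⁻¹)) (by simpa using h1)
    exact ⟨x⁻¹ * t, htW, hV'V ht⟩

theorem nonseparatedSubgroup_normal (hl : ∀ b : E, Continuous fun x => b * x)
    (hr : ∀ b : E, Continuous fun x => x * b) : (nonseparatedSubgroup hl hr).Normal := by
  refine ⟨fun x hx g V hV => mem_closure_iff.2 fun W hW hxW => ?_⟩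
  have hc : Continuous fun t => g * t * g⁻¹ := (hr g⁻¹).comp (hl g)
  have hV' : {t | g * t * g⁻¹ ∈ V} ∈ 𝓝 (1 : E) := hc.continuousAt.preimage_mem_nhds (by simpa using hV)
  obtain ⟨t, htW, htV⟩ := mem_closure_iff.1 (hx _ hV') _ (hW.preimage hc) hxW
  exact ⟨_, htW, htV⟩

end Semitopological

/-! ### The Ellis group and its `τ`-topology -/

section EllisGroup

variable {L : FirstOrder.Language.{u, v}} {M : Type w'} {C : Type w} [L.Structure M]
  [L.Structure C] {n : ℕ} {𝒢 : DefinableGroup L M n} {j : M ↪ₑ[L] C} {Δ : FormulaSet L n}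

theorem circ_mono (p : Univ 𝒢 j Δ) {A B : Set (Univ 𝒢 j Δ)} (h : A ⊆ B) : circ p A ⊆ circ p B := by
  rintro x ⟨F, h1, h2, h3⟩
  exact ⟨F, h1, h2.mono fun z hz => h hz, h3⟩

/-- A neighbourhood form without nets, from which the filter is recovered as a pullback of the
neighbourhoods of `(p, x)`. -/
theorem mem_circ_iff {p x : Univ 𝒢 j Δ} {A : Set (Univ 𝒢 j Δ)} :
    x ∈ circ p A ↔ ∀ V ∈ 𝓝 p, ∀ W ∈ 𝓝 x,
      ∃ g : Pt 𝒢, ∃ a ∈ A, toUniv 𝒢 j Δ (incl 𝒢 j g) ∈ V ∧ g • a ∈ W := by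
  constructor
  · rintro ⟨F, h1, h2, h3, h4⟩ V hV W hW
    obtain ⟨z, ⟨hz1, hz2⟩, hz3⟩ := ((h2.and (h3 hV)).and (h4 hW)).exists
    exact ⟨z.1, z.2, hz1, hz2, hz3⟩
  · intro h
    let f : Pt 𝒢 × Univ 𝒢 j Δ → Univ 𝒢 j Δ × Univ 𝒢 j Δ :=
      fun z => (toUniv 𝒢 j Δ (incl 𝒢 j z.1), z.1 • z.2)
    have hf : Tendsto f (comap f (𝓝 (p, x)) ⊓ 𝓟 {z | z.2 ∈ A}) (𝓝 p ×ˢ 𝓝 x) := by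
      rw [← nhds_prod_eq]
      exact tendsto_comap.mono_left inf_le_left
    refine ⟨comap f (𝓝 (p, x)) ⊓ 𝓟 {z | z.2 ∈ A}, ?_, mem_inf_of_right (mem_principal_self _),
      tendsto_fst.comp hf, tendsto_snd.comp hf⟩
    rw [inf_principal_neBot_iff]
    rintro s ⟨t, ht, hts⟩
    rw [nhds_prod_eq, mem_prod_iff] at ht
    obtain ⟨V, hV, W, hW, hVW⟩ := ht
    obtain ⟨g, a, ha, hg, hga⟩ := h V hV W hW
    exact ⟨(g, a), hts (hVW ⟨hg, hga⟩), ha⟩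

variable {I : Set (Univ 𝒢 j Δ)} {u : Univ 𝒢 j Δ}

theorem isClosed_ellis_iff {A : Set (EllisGroup I u)} : IsClosed A ↔ clTau A ⊆ A := by
  rw [← isOpen_compl_iff]
  change Aᶜᶜ ∈ {A : Set (EllisGroup I u) | clTau A ⊆ A} ↔ _
  rw [compl_compl, Set.mem_ofPred_eq]

theorem continuous_of_mapsTo_clTau {f : EllisGroup I u → EllisGroup I u}
    (h : ∀ A, ∀ x ∈ clTau A, f x ∈ clTau (f '' A)) : Continuous f := by
  refine continuous_iff_isClosed.2 fun B hB => isClosed_ellis_iff.2 fun x hx => ?_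
  exact isClosed_ellis_iff.1 hB (clTau_mono (Set.image_preimage_subset f B) (h _ x hx))

theorem EllisGroup.val_mem (hI : IsMinimalLeftIdeal I) (p : EllisGroup I u) : p.1 ∈ I := by
  obtain ⟨m, hm, h⟩ := p.mem
  exact h ▸ hI.prop.2 u m hm

variable [CompactSpace (StarPt 𝒢 j)] [CompactSpace (DeltaStar 𝒢 j Δ)]

theorem mul_mem_circ (p : Univ 𝒢 j Δ) {a : Univ 𝒢 j Δ} {A : Set (Univ 𝒢 j Δ)} (ha : a ∈ A) :
    p * a ∈ circ p A := by
  refine mem_circ_iff.2 fun V hV W hW => ?_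
  have := comap_toUniv_incl_neBot p
  obtain ⟨g, hg, hgW⟩ := ((tendsto_comap.eventually_mem hV).and
    ((tendsto_smul_mul p a).eventually_mem hW)).exists
  exact ⟨g, a, ha, hg, hgW⟩

/-- Choose `g` near `p` so that `g • q` is near `p * q` and `g • y` near `x`; with `g` fixed,
approximate `y` by `h • a` with `h` near `q`. The product `g * h` then works. -/
theorem circ_circ_subset (p q : Univ 𝒢 j Δ) (A : Set (Univ 𝒢 j Δ)) :
    circ p (circ q A) ⊆ circ (p * q) A := by
  intro x hx
  refine mem_circ_iff.2 fun V hV W hW => ?_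
  obtain ⟨V', hV'V, hV', hpq⟩ := mem_nhds_iff.1 hV
  obtain ⟨W', hW'W, hW', hxW⟩ := mem_nhds_iff.1 hW
  obtain ⟨g, y, hy, hg, hgy⟩ := mem_circ_iff.1 hx _
    ((hV'.preimage (continuous_mul_univ q)).mem_nhds hpq) W' (hW'.mem_nhds hxW)
  have hgq : g • q ∈ V' := by
    rw [← toUniv_incl_mul]
    exact hg
  obtain ⟨h, a, ha, hh, hha⟩ := mem_circ_iff.1 hy _
    ((hV'.preimage (continuous_smul_univ g)).mem_nhds hgq) _
    ((hW'.preimage (continuous_smul_univ g)).mem_nhds hgy)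
  refine ⟨g * h, a, ha, hV'V ?_, hW'W ?_⟩
  · rw [toUniv_incl_eq, mul_smul, ← toUniv_incl_eq]
    exact hh
  · rw [mul_smul]
    exact hha

theorem EllisGroup.unit_mul (huu : u * u = u) (p : EllisGroup I u) : u * p.1 = p.1 := by
  obtain ⟨m, -, h⟩ := p.mem
  rw [← h, ← mul_assoc_univ, huu]

theorem subset_clTau (huu : u * u = u) (A : Set (EllisGroup I u)) : A ⊆ clTau A := by
  intro a ha
  have h := mul_mem_circ u (Set.mem_image_of_mem EllisGroup.val ha)
  rwa [a.unit_mul huu] at h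

theorem clTau_clTau (huu : u * u = u) (A : Set (EllisGroup I u)) :
    clTau (clTau A) ⊆ clTau A := by
  intro x hx
  have h1 : EllisGroup.val '' clTau A ⊆ circ u (EllisGroup.val '' A) := by
    rintro _ ⟨y, hy, rfl⟩
    exact hy
  have h2 := circ_circ_subset u u _ (circ_mono u h1 hx)
  rw [huu] at h2
  exact h2

theorem closure_ellis_eq (huu : u * u = u) (A : Set (EllisGroup I u)) : closure A = clTau A := by
  refine Set.Subset.antisymm (closure_minimal (subset_clTau huu A)
    (isClosed_ellis_iff.2 (clTau_clTau huu A))) ?_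
  exact (clTau_mono subset_closure).trans (isClosed_ellis_iff.1 isClosed_closure)

/-- The set `I * m` is a left ideal inside `I`, so minimality forces equality. -/
theorem IsMinimalLeftIdeal.exists_mul_eq (hI : IsMinimalLeftIdeal I) {m x : Univ 𝒢 j Δ}
    (hm : m ∈ I) (hx : x ∈ I) : ∃ p ∈ I, p * m = x := by
  have h : {y | ∃ p ∈ I, p * m = y} = I := by
    refine hI.eq_of_subset ⟨⟨m * m, m, hm, rfl⟩, ?_⟩ ?_
    · rintro p _ ⟨q, hq, rfl⟩
      exact ⟨p * q, hI.prop.2 p q hq, mul_assoc_univ p q m⟩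
    · rintro _ ⟨p, -, rfl⟩
      exact hI.prop.2 p m hm
  rw [← h] at hx
  exact hx

/-- The group structure of the Ellis group `uℳ`. -/
@[reducible]
noncomputable def ellisGroupStructure (hI : IsMinimalLeftIdeal I) (hu : u ∈ I) (huu : u * u = u) :
    Group (EllisGroup I u) :=
  have hinv : ∀ p : EllisGroup I u, ∃ q : EllisGroup I u, q.1 * p.1 = u := fun p => by
    obtain ⟨q, hq, hqp⟩ := hI.exists_mul_eq (p.val_mem hI) hu
    exact ⟨⟨u * q, q, hq, rfl⟩, by rw [mul_assoc_univ, hqp, huu]⟩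
  let _ : Mul (EllisGroup I u) := ⟨fun p q => ⟨p.1 * q.1, p.1 * q.1,
    hI.prop.2 _ _ (q.val_mem hI), by rw [← mul_assoc_univ, p.unit_mul huu]⟩⟩
  let _ : One (EllisGroup I u) := ⟨ellisUnit hu huu⟩
  let _ : Inv (EllisGroup I u) := ⟨fun p => (hinv p).choose⟩
  Group.ofLeftAxioms (fun p q r => EllisGroup.ext (mul_assoc_univ p.1 q.1 r.1))
    (fun p => EllisGroup.ext (p.unit_mul huu))
    (fun p => EllisGroup.ext (hinv p).choose_spec)

section Translations

variable [Group (EllisGroup I u)]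

/-- Right multiplication on the ambit is continuous and commutes with `G`, so it carries
approximating nets to approximating nets. -/
theorem continuous_ellis_mul_right (hmul : ∀ p q : EllisGroup I u, (p * q).1 = p.1 * q.1)
    (b : EllisGroup I u) : Continuous fun x : EllisGroup I u => x * b := by
  refine continuous_of_mapsTo_clTau fun A x hx => ?_
  refine mem_circ_iff.2 fun V hV W hW => ?_
  rw [hmul] at hW
  obtain ⟨g, _, ⟨a, ha, rfl⟩, hg, hga⟩ := mem_circ_iff.1 hx V hV _
    ((continuous_mul_univ b.1).continuousAt.preimage_mem_nhds hW)
  refine ⟨g, (a * b).1, ⟨a * b, ⟨a, ha, rfl⟩, rfl⟩, hg, ?_⟩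
  rw [hmul, ← smul_mul_univ]
  exact hga

/-- Only right multiplications on the ambit are known to be continuous, so the calculus of `circ` is
used: $bx\in b\circ(u\circ A)\subseteq b\circ A\subseteq b\circ(b^{-1}\circ bA)\subseteq u\circ bA$.
-/
theorem continuous_ellis_mul_left (hmul : ∀ p q : EllisGroup I u, (p * q).1 = p.1 * q.1)
    (hone : (1 : EllisGroup I u).1 = u) (b : EllisGroup I u) :
    Continuous fun x : EllisGroup I u => b * x := by
  refine continuous_of_mapsTo_clTau fun A x hx => ?_
  have h1 : EllisGroup.val '' A ⊆ circ b⁻¹.1 (EllisGroup.val '' ((fun x => b * x) '' A)) := by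
    rintro _ ⟨a, ha, rfl⟩
    have h := mul_mem_circ b⁻¹.1
      (Set.mem_image_of_mem EllisGroup.val (Set.mem_image_of_mem (fun x => b * x) ha))
    rwa [← hmul, inv_mul_cancel_left] at h
  have h2 : (b * x).1 ∈ circ b.1 (EllisGroup.val '' A) := by
    have hbu : b.1 * u = b.1 := by
      have h := hmul b 1
      rwa [mul_one, hone, eq_comm] at h
    have h := circ_circ_subset b.1 u _ (mul_mem_circ b.1 hx)
    rwa [← hmul, hbu] at h
  have h3 := circ_circ_subset _ _ _ (circ_mono b.1 h1 h2)
  rw [← hmul, mul_inv_cancel, hone] at h3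
  exact h3

end Translations

end EllisGroup

/-! ### The quotient of `G*` by the connected component -/

section Component

variable {L : FirstOrder.Language.{u, v}} {M : Type w'} {C : Type w} [L.Structure M]
  [L.Structure C] {n : ℕ} {κ : Cardinal.{w}} {𝒢 : DefinableGroup L M n} {j : M ↪ₑ[L] C}
  {Δ : FormulaSet L n}

theorem IsDefinableOver.inv_mul_const {A : Set C} (hA : Set.range j ⊆ A) {s : Set (StarPt 𝒢 j)}
    (hs : IsDefinableOver (Set.range j) s) (r : StarPt 𝒢 j) (hr : ∀ i, r.1 i ∈ A) :
    IsDefinableOver A {x | x⁻¹ * r ∈ s} := by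
  have h1 : ∀ i, (1 : StarPt 𝒢 j).1 i ∈ A := fun i => hA (one_val_mem_range i)
  simpa using ((hs.mono hA).inv_mul 1 r h1 hr).right_slice 1 h1

/-- A set definable over `A` that contains a realization of the type over `A` given by an
ultrafilter belongs to the ultrafilter. -/
theorem mem_of_mem_realization {A : Set C} {W : Ultrafilter (StarPt 𝒢 j)} {c : StarPt 𝒢 j}
    (hc : ∀ D, IsDefinableOver A D → D ∈ (W : Filter (StarPt 𝒢 j)) → c ∈ D)
    {D : Set (StarPt 𝒢 j)} (hD : IsDefinableOver A D) (hcD : c ∈ D) :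
    D ∈ (W : Filter (StarPt 𝒢 j)) := by
  by_contra h
  exact hc _ hD.compl (Ultrafilter.compl_mem_iff_notMem.2 h) hcD

/-- The left coset of an element of `G*` modulo a `Δ`-type-definable over `M` subgroup of bounded
index depends only on the `Δ`-type of the element over `M`. -/
theorem IsMonster.inv_mul_mem_of_deltaType_eq (hC : IsMonster L M C κ) {H : Subgroup (StarPt 𝒢 j)}
    (hH : IsDeltaTypeDefinable 𝒢 j Δ (H : Set (StarPt 𝒢 j))) (hidx : #(StarPt 𝒢 j ⧸ H) < κ)
    {a b : StarPt 𝒢 j} (hab : ∀ D ∈ deltaSetsStar 𝒢 j Δ, a ∈ D ↔ b ∈ D) : a⁻¹ * b ∈ H := by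
  obtain ⟨S, hS, e⟩ := hH
  have hSdef : ∀ s ∈ S, IsDefinableOver (Set.range j) s :=
    fun s hs => isDefinableOver_of_mem_deltaSetsStar (hS s hs)
  have memH : ∀ x, x ∈ H ↔ ∀ s ∈ S, x ∈ s := by
    intro x
    rw [← SetLike.mem_coe, e, Set.mem_sInter]
  have hne : (comap (inclDelta 𝒢 j Δ) (𝓝 (toDelta Δ a))).NeBot :=
    comap_neBot_iff.2 fun t ht =>
      let ⟨_, hx, g, hg⟩ := mem_closure_iff_nhds.1 (denseRange_inclDelta (toDelta Δ a)) t ht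
      ⟨g, by simpa only [hg] using hx⟩
  -- An ultrafilter living on `G` and refining the `Δ`-type of `a`: its image `W` gives a type over
  -- every parameter set, finitely satisfiable in `G`.
  let V := Ultrafilter.of (comap (inclDelta 𝒢 j Δ) (𝓝 (toDelta Δ a)))
  let W : Ultrafilter (StarPt 𝒢 j) := V.map (incl 𝒢 j)
  have hWa : ∀ D ∈ deltaSetsStar 𝒢 j Δ, a ∈ D → D ∈ (W : Filter (StarPt 𝒢 j)) := by
    intro D hD haD
    exact Ultrafilter.of_le _ (preimage_mem_comap
      ((isOpen_of_mem_deltaSetsStar (𝒢 := 𝒢) (j := j) hD).mem_nhds haD))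
  let R : Set (StarPt 𝒢 j) := Set.range (Quotient.out : StarPt 𝒢 j ⧸ H → StarPt 𝒢 j)
  have hA₁ := hC.mk_union_coords_lt (hC.mk_range_lt j) (Cardinal.mk_range_le.trans_lt hidx : #R < κ)
  set A₁ : Set C := Set.range j ∪ {x | ∃ r ∈ R, ∃ i, r.1 i = x}
  have hjA₁ : Set.range j ⊆ A₁ := Set.subset_union_left
  obtain ⟨c, hc⟩ := hC.saturated.exists_mem_of_filter_star hA₁ (W : Filter (StarPt 𝒢 j))
  have hsing : ∀ x : StarPt 𝒢 j, #({x} : Set (StarPt 𝒢 j)) < κ := fun x =>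
    (Cardinal.lt_aleph0_of_finite _).trans hC.aleph0_lt
  have hA₂ := hC.mk_union_coords_lt hA₁ (hsing c)
  set A₂ : Set C := A₁ ∪ {x | ∃ r ∈ ({c} : Set (StarPt 𝒢 j)), ∃ i, r.1 i = x}
  have hA₁₂ : A₁ ⊆ A₂ := Set.subset_union_left
  obtain ⟨c', hc'⟩ := hC.saturated.exists_mem_of_filter_star hA₂ (W : Filter (StarPt 𝒢 j))
  let r : StarPt 𝒢 j := (QuotientGroup.mk c : StarPt 𝒢 j ⧸ H).out
  have hrc : c⁻¹ * r ∈ H := QuotientGroup.eq.1 (QuotientGroup.out_eq' _).symm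
  have hrA : ∀ i, r.1 i ∈ A₁ := fun i => Or.inr ⟨r, ⟨_, rfl⟩, i, rfl⟩
  -- The parameters include representatives of all cosets of `H`, so the type of `c` decides its
  -- coset, and `c'`, with the same type over `A₁`, shares it.
  have hrc' : c'⁻¹ * r ∈ H := by
    refine (memH _).2 fun s hs => ?_
    have hd := (hSdef s hs).inv_mul_const hjA₁ r hrA
    exact hc' _ (hd.mono hA₁₂) (mem_of_mem_realization hc hd ((memH _).1 hrc s hs))
  have hcc' : c'⁻¹ * c ∈ H := by
    have h := H.mul_mem hrc' (H.inv_mem hrc)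
    rwa [mul_inv_rev, inv_inv, mul_assoc, mul_inv_cancel_left] at h
  have hca : ∀ D ∈ deltaSetsStar 𝒢 j Δ, c ∈ D ↔ a ∈ D := by
    intro D hD
    have hD' := (isDefinableOver_of_mem_deltaSetsStar hD).mono hjA₁
    refine ⟨fun h => ?_, fun h => hc D hD' (hWa D hD h)⟩
    by_contra haD
    exact hc _ hD'.compl (hWa _ (BooleanSubalgebra.compl_mem hD) haD) h
  have hcW : ∀ s ∈ S, {x | x⁻¹ * c ∈ s} ∈ (W : Filter (StarPt 𝒢 j)) := by
    intro s hs
    refine mem_of_mem_realization hc' ((hSdef s hs).inv_mul_const (hjA₁.trans hA₁₂) c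
      fun i => Or.inr ⟨c, rfl, i, rfl⟩) ((memH _).1 hcc' s hs)
  -- As `W` lives on `G`, the condition on `x` may be tested at `g ∈ G`; there `g⁻¹ * c ∈ s` is a
  -- `Δ`-condition over `M` on `c`, so it passes to every `y` with the same `Δ`-type.
  have htransfer : ∀ y, (∀ D ∈ deltaSetsStar 𝒢 j Δ, c ∈ D ↔ y ∈ D) → ∀ s ∈ S,
      {x | x⁻¹ * y ∈ s} ∈ (W : Filter (StarPt 𝒢 j)) := by
    intro y hy s hs
    have h : {g : Pt 𝒢 | (incl 𝒢 j g)⁻¹ * c ∈ s} ∈ (V : Filter (Pt 𝒢)) := hcW s hs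
    refine Ultrafilter.mem_map.2 (Filter.mem_of_superset h fun g hg => ?_)
    have hinv : (incl 𝒢 j g)⁻¹ = incl 𝒢 j g⁻¹ := ((inclHom 𝒢 j).map_inv g).symm
    have hg' : (incl 𝒢 j g)⁻¹ * c ∈ s := hg
    change (incl 𝒢 j g)⁻¹ * y ∈ s
    rw [hinv] at hg' ⊢
    exact (hy _ (translate_mem 𝒢 j Δ g⁻¹ s (hS s hs))).1 hg'
  have hA₃ := hC.mk_union_coords_lt (hC.mk_union_coords_lt (hC.mk_range_lt j) (hsing a)) (hsing b)
  -- A realization of `W` over `a` and `b` lies in the left coset of each of them.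
  obtain ⟨d, hd⟩ := hC.saturated.exists_mem_of_filter_star hA₃ (W : Filter (StarPt 𝒢 j))
  have hda : d⁻¹ * a ∈ H := (memH _).2 fun s hs =>
    hd _ ((hSdef s hs).inv_mul_const
      (Set.subset_union_left.trans Set.subset_union_left) a
      fun i => Or.inl (Or.inr ⟨a, rfl, i, rfl⟩)) (htransfer a hca s hs)
  have hdb : d⁻¹ * b ∈ H := (memH _).2 fun s hs =>
    hd _ ((hSdef s hs).inv_mul_const
      (Set.subset_union_left.trans Set.subset_union_left) b
      fun i => Or.inr ⟨b, rfl, i, rfl⟩)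
      (htransfer b (fun D hD => (hca D hD).trans (hab D hD)) s hs)
  have h := H.mul_mem (H.inv_mem hda) hdb
  rwa [mul_inv_rev, inv_inv, mul_assoc, mul_inv_cancel_left] at h

theorem IsMonster.inv_mul_mem_component (hC : IsMonster L M C κ)
    {a b : StarPt 𝒢 j} (hab : ∀ D ∈ deltaSetsStar 𝒢 j Δ, a ∈ D ↔ b ∈ D) :
    a⁻¹ * b ∈ component 𝒢 j Δ κ :=
  Subgroup.mem_sInf.2 fun _ hH => hC.inv_mul_mem_of_deltaType_eq hH.1 hH.2 hab

theorem isClosed_component :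
    IsClosed ((component 𝒢 j Δ κ : Subgroup (StarPt 𝒢 j)) : Set (StarPt 𝒢 j)) := by
  rw [component, Subgroup.coe_sInf]
  refine isClosed_biInter fun H hH => ?_
  exact (isClosed_delta_iff.2 hH.1).preimage continuous_toDelta

/-- Pulling back along conjugation by an element of `G` preserves `Δ`-type-definability and
boundedness of the index, hence the family being intersected. -/
theorem incl_conj_mem_component (g : Pt 𝒢) {x : StarPt 𝒢 j} (hx : x ∈ component 𝒢 j Δ κ) :
    incl 𝒢 j g * x * (incl 𝒢 j g)⁻¹ ∈ component 𝒢 j Δ κ := by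
  refine Subgroup.mem_sInf.2 fun H hH => ?_
  let f : StarPt 𝒢 j →* StarPt 𝒢 j := (MulAut.conj (incl 𝒢 j g)).toMonoidHom
  refine Subgroup.mem_sInf.1 hx (H.comap f) ⟨?_, ?_⟩
  · refine isClosed_delta_iff.1 ?_
    have hcont : Continuous fun a : DeltaStar 𝒢 j Δ =>
        inclDelta 𝒢 j Δ g * a * inclDelta 𝒢 j Δ g⁻¹ :=
      (continuous_mul_inclDelta g⁻¹).comp (continuous_inclDelta_mul g)
    rw [map_inv] at hcont
    exact (isClosed_delta_iff.2 hH.1).preimage hcont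
  · refine lt_of_le_of_lt (Cardinal.mk_le_of_injective
      (f := Quotient.map' f fun a b hab => ?_) ?_) hH.2
    · rw [QuotientGroup.leftRel_apply] at hab ⊢
      rw [← map_inv, ← map_mul]
      exact hab
    · rintro ⟨a⟩ ⟨b⟩ h
      have h' := QuotientGroup.leftRel_apply.1 (Quotient.exact h)
      refine Quotient.sound (QuotientGroup.leftRel_apply.2 ?_)
      rw [← map_inv, ← map_mul] at h'
      exact h'

/-! ### Closedness of coset-invariant conditions and normality -/

/-- A subset of `G* × G*` that is type-definable over a small set and a union of products of left
cosets of the component is closed in the `Δ`-topology. -/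
theorem IsMonster.isClosed_of_coset_invariant (hC : IsMonster L M C κ) {A : Set C} (hA : #A < κ)
    (hjA : Set.range j ⊆ A) {S : Set (Set (StarPt 𝒢 j × StarPt 𝒢 j))}
    (hS : ∀ s ∈ S, IsDefinableOver₂ A s)
    (hinv : ∀ x x' y y', (x, y) ∈ ⋂₀ S → x⁻¹ * x' ∈ component 𝒢 j Δ κ →
      y⁻¹ * y' ∈ component 𝒢 j Δ κ → (x', y') ∈ ⋂₀ S) :
    IsClosed {z : DeltaStar 𝒢 j Δ × DeltaStar 𝒢 j Δ | (ofDelta z.1, ofDelta z.2) ∈ ⋂₀ S} := by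
  refine isClosed_iff_clusterPt.2 fun z hz => ?_
  let F := 𝓝 z ⊓ 𝓟 {z : DeltaStar 𝒢 j Δ × DeltaStar 𝒢 j Δ | (ofDelta z.1, ofDelta z.2) ∈ ⋂₀ S}
  have hF : F.NeBot := hz
  -- The pair `c` lies in the set and has coordinatewise the `Δ`-types of `z`, hence the same
  -- cosets; invariance moves membership from `c` to `z`.
  obtain ⟨c, hc⟩ := hC.saturated.exists_mem_of_filter_star₂ hA
    (F.map fun z => (ofDelta z.1, ofDelta z.2))
  have h1 : ∀ D ∈ deltaSetsStar 𝒢 j Δ, ofDelta z.1 ∈ D → c.1 ∈ D := fun D hD hzD =>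
    hc _ ((isDefinableOver_of_mem_deltaSetsStar hD).mono hjA).preimage_fst
      (mem_map.2 (mem_inf_of_left (((isOpen_of_mem_deltaSetsStar
        (𝒢 := 𝒢) (j := j) hD).preimage continuous_fst).mem_nhds hzD)))
  have h2 : ∀ D ∈ deltaSetsStar 𝒢 j Δ, ofDelta z.2 ∈ D → c.2 ∈ D := fun D hD hzD =>
    hc _ ((isDefinableOver_of_mem_deltaSetsStar hD).mono hjA).preimage_snd
      (mem_map.2 (mem_inf_of_left (((isOpen_of_mem_deltaSetsStar
        (𝒢 := 𝒢) (j := j) hD).preimage continuous_snd).mem_nhds hzD)))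
  have hiff : ∀ x y : StarPt 𝒢 j, (∀ D ∈ deltaSetsStar 𝒢 j Δ, x ∈ D → y ∈ D) →
      ∀ D ∈ deltaSetsStar 𝒢 j Δ, y ∈ D ↔ x ∈ D := by
    intro x y h D hD
    refine ⟨fun hy => ?_, h D hD⟩
    by_contra hx
    exact h Dᶜ (BooleanSubalgebra.compl_mem hD) hx hy
  refine hinv c.1 _ c.2 _ ?_ (hC.inv_mul_mem_component (hiff _ _ h1))
    (hC.inv_mul_mem_component (hiff _ _ h2))
  intro s hs
  exact hc s (hS s hs) (mem_map.2 (mem_inf_of_right fun z hz => hz s hs))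

theorem IsMonster.isClosed_inv_mul_mem (hC : IsMonster L M C κ) {D : Set (StarPt 𝒢 j)}
    (hD : IsClosed D)
    (hinv : ∀ m ∈ component 𝒢 j Δ κ, ∀ d ∈ D, ∀ k ∈ component 𝒢 j Δ κ, m * d * k ∈ D)
    (c : StarPt 𝒢 j) :
    IsClosed {z : DeltaStar 𝒢 j Δ × DeltaStar 𝒢 j Δ |
      (ofDelta z.1)⁻¹ * (c * ofDelta z.2) ∈ D} := by
  obtain ⟨S, hS, rfl⟩ := isTypeDefinable_iff.1 (isClosed_star_iff.1 hD)
  have hsing : #({c} : Set (StarPt 𝒢 j)) < κ :=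
    (Cardinal.lt_aleph0_of_finite _).trans hC.aleph0_lt
  have hA := hC.mk_union_coords_lt (hC.mk_range_lt j) hsing
  set A : Set C := Set.range j ∪ {x | ∃ r ∈ ({c} : Set (StarPt 𝒢 j)), ∃ i, r.1 i = x}
  have hjA : Set.range j ⊆ A := Set.subset_union_left
  let P : Set (StarPt 𝒢 j) → Set (StarPt 𝒢 j × StarPt 𝒢 j) :=
    fun s => {z | z.1⁻¹ * (c * z.2 * 1) ∈ s}
  have hP : ∀ x y, (x, y) ∈ ⋂₀ (P '' S) ↔ x⁻¹ * (c * y) ∈ ⋂₀ S := by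
    intro x y
    simp [P]
  have h := hC.isClosed_of_coset_invariant (Δ := Δ) hA hjA (S := P '' S) (by
    rintro _ ⟨s, hs, rfl⟩
    exact ((hS s hs).mono hjA).inv_mul c 1 (fun i => Or.inr ⟨c, rfl, i, rfl⟩)
      fun i => hjA (one_val_mem_range i)) (by
    intro x x' y y' hxy hx hy
    rw [hP] at hxy ⊢
    have h := hinv _ (inv_mem hx) _ hxy _ hy
    have e : (x⁻¹ * x')⁻¹ * (x⁻¹ * (c * y)) * (y⁻¹ * y') = x'⁻¹ * (c * y') := by group
    rwa [e] at h)
  simpa only [hP] using h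

/-- For fixed `m` in the component, the set of `x` with `x⁻¹ * m * x` in the component is closed in
the `Δ`-topology and contains the dense subgroup `G`. -/
theorem IsMonster.component_normal (hC : IsMonster L M C κ) : (component 𝒢 j Δ κ).Normal := by
  refine ⟨fun m hm g => ?_⟩
  have hcl := hC.isClosed_inv_mul_mem (Δ := Δ) isClosed_component
    (fun m hm d hd k hk => mul_mem (mul_mem hm hd) hk) m
  have hcl' : IsClosed {x : DeltaStar 𝒢 j Δ |
      (ofDelta x)⁻¹ * (m * ofDelta x) ∈ component 𝒢 j Δ κ} :=
    hcl.preimage (continuous_id.prodMk continuous_id)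
  have hall : ∀ x : DeltaStar 𝒢 j Δ, (ofDelta x)⁻¹ * (m * ofDelta x) ∈ component 𝒢 j Δ κ := by
    refine fun x => denseRange_inclDelta.induction_on x hcl' fun k => ?_
    have h := incl_conj_mem_component k⁻¹ hm
    rw [show incl 𝒢 j k⁻¹ = (incl 𝒢 j k)⁻¹ from (inclHom 𝒢 j).map_inv k, inv_inv, mul_assoc] at h
    exact h
  have h : g⁻¹⁻¹ * (m * g⁻¹) ∈ component 𝒢 j Δ κ := hall (toDelta Δ g⁻¹)
  rwa [inv_inv, ← mul_assoc] at h

/-! ### The quotient as a compact Hausdorff group -/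

/-- The quotient map of `G*` by the component, on `G*` with the `Δ`-topology. -/
noncomputable def deltaToQuotient (𝒢 : DefinableGroup L M n) (j : M ↪ₑ[L] C) (Δ : FormulaSet L n)
    (κ : Cardinal.{w}) (a : DeltaStar 𝒢 j Δ) : StarPt 𝒢 j ⧸ component 𝒢 j Δ κ :=
  QuotientGroup.mk (ofDelta a)

theorem deltaToQuotient_surjective : Function.Surjective (deltaToQuotient 𝒢 j Δ κ) :=
  QuotientGroup.mk_surjective

theorem isClosed_quotient_iff {Y : Set (StarPt 𝒢 j ⧸ component 𝒢 j Δ κ)} :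
    IsClosed Y ↔ IsClosed ((QuotientGroup.mk : StarPt 𝒢 j → _) ⁻¹' Y) :=
  (isQuotientMap_quot_mk (X := StarPt 𝒢 j)).isClosed_preimage.symm

variable [(component 𝒢 j Δ κ).Normal]

theorem IsMonster.isClosed_inv_mul_mem_quotient (hC : IsMonster L M C κ)
    {Y : Set (StarPt 𝒢 j ⧸ component 𝒢 j Δ κ)} (hY : IsClosed Y) :
    IsClosed {z : DeltaStar 𝒢 j Δ × DeltaStar 𝒢 j Δ |
      (deltaToQuotient 𝒢 j Δ κ z.1)⁻¹ * deltaToQuotient 𝒢 j Δ κ z.2 ∈ Y} := by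
  have h := hC.isClosed_inv_mul_mem (Δ := Δ) (isClosed_quotient_iff.1 hY)
    (fun m hm d hd k hk => by
      rw [Set.mem_preimage, QuotientGroup.mk_mul, QuotientGroup.mk_mul,
        (QuotientGroup.eq_one_iff m).2 hm, (QuotientGroup.eq_one_iff k).2 hk, one_mul, mul_one]
      exact hd) 1
  simp only [one_mul] at h
  exact h

theorem IsMonster.continuous_deltaToQuotient (hC : IsMonster L M C κ) :
    Continuous (deltaToQuotient 𝒢 j Δ κ) := by
  refine continuous_iff_isClosed.2 fun Y hY => ?_
  have h := (hC.isClosed_inv_mul_mem_quotient hY).preimage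
    (continuous_const.prodMk continuous_id :
      Continuous fun y : DeltaStar 𝒢 j Δ => ((1 : DeltaStar 𝒢 j Δ), y))
  have e : deltaToQuotient 𝒢 j Δ κ 1 = 1 := rfl
  simp only [Set.preimage_ofPred_eq, e, inv_one, one_mul] at h
  exact h

theorem isClosed_singleton_one_quotient :
    IsClosed ({1} : Set (StarPt 𝒢 j ⧸ component 𝒢 j Δ κ)) := by
  rw [isClosed_quotient_iff]
  convert isClosed_component (𝒢 := 𝒢) (j := j) (Δ := Δ) (κ := κ) using 1
  ext x
  exact QuotientGroup.eq_one_iff x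

/-- The coset relation is closed and the `Δ`-topology compact, so saturations of closed sets are
closed. Properness, unlike being a quotient map, survives products, as continuity of the group
operations requires. -/
theorem IsMonster.isProperMap_deltaToQuotient (hC : IsMonster L M C κ) :
    IsProperMap (deltaToQuotient 𝒢 j Δ κ) := by
  have := hC.compactSpace_delta (𝒢 := 𝒢) (j := j) (Δ := Δ)
  have hR : IsClosed {z : DeltaStar 𝒢 j Δ × DeltaStar 𝒢 j Δ |
      deltaToQuotient 𝒢 j Δ κ z.1 = deltaToQuotient 𝒢 j Δ κ z.2} := by
    simpa only [Set.mem_singleton_iff, inv_mul_eq_one] using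
      hC.isClosed_inv_mul_mem_quotient (isClosed_singleton_one_quotient (Δ := Δ))
  have hclosed : IsClosedMap (deltaToQuotient 𝒢 j Δ κ) := by
    intro F hF
    rw [isClosed_quotient_iff]
    have h := (isClosedMap_snd_of_compactSpace _
      (hR.inter (hF.preimage continuous_fst))).preimage continuous_toDelta
    convert h using 1
    ext y
    constructor
    · rintro ⟨x, hx, hxy⟩
      exact ⟨(x, toDelta Δ y), ⟨hxy, hx⟩, rfl⟩
    · rintro ⟨⟨x, y'⟩, ⟨hxy, hx⟩, rfl⟩
      exact ⟨x, hx, hxy⟩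
  refine isProperMap_iff_isClosedMap_and_compact_fibers.2
    ⟨hC.continuous_deltaToQuotient, hclosed, fun q => IsClosed.isCompact ?_⟩
  obtain ⟨a, rfl⟩ := deltaToQuotient_surjective q
  exact hR.preimage
    (continuous_id.prodMk continuous_const : Continuous fun y : DeltaStar 𝒢 j Δ => (y, a))

theorem IsMonster.isTopologicalGroup_quotient (hC : IsMonster L M C κ) :
    IsTopologicalGroup (StarPt 𝒢 j ⧸ component 𝒢 j Δ κ) := by
  have hp := hC.isProperMap_deltaToQuotient (𝒢 := 𝒢) (j := j) (Δ := Δ)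
  have hdiv : Continuous fun z : (StarPt 𝒢 j ⧸ component 𝒢 j Δ κ) ×
      (StarPt 𝒢 j ⧸ component 𝒢 j Δ κ) => z.1⁻¹ * z.2 := by
    refine continuous_iff_isClosed.2 fun Y hY => ?_
    have h := (hp.prodMap hp).isClosedMap _ (hC.isClosed_inv_mul_mem_quotient hY)
    convert h using 1
    ext ⟨p, q⟩
    constructor
    · intro hpq
      obtain ⟨a, rfl⟩ := deltaToQuotient_surjective p
      obtain ⟨b, rfl⟩ := deltaToQuotient_surjective q
      exact ⟨(a, b), hpq, rfl⟩
    · rintro ⟨⟨a, b⟩, hab, e⟩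
      cases e
      exact hab
  have hinv : Continuous fun p : StarPt 𝒢 j ⧸ component 𝒢 j Δ κ => p⁻¹ := by
    simpa [Function.comp_def] using hdiv.comp (continuous_id.prodMk continuous_const :
      Continuous fun p : StarPt 𝒢 j ⧸ component 𝒢 j Δ κ => (p, (1 : StarPt 𝒢 j ⧸ _)))
  refine { continuous_mul := ?_, continuous_inv := hinv }
  simpa [Function.comp_def] using hdiv.comp ((hinv.comp continuous_fst).prodMk continuous_snd)

theorem IsMonster.t2Space_quotient (hC : IsMonster L M C κ) :
    T2Space (StarPt 𝒢 j ⧸ component 𝒢 j Δ κ) := by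
  have := hC.isTopologicalGroup_quotient (𝒢 := 𝒢) (j := j) (Δ := Δ)
  exact IsTopologicalGroup.t2Space_iff_one_closed.2 isClosed_singleton_one_quotient

end Component

/-! ### The map from the universal ambit to the quotient by the component -/

section Theta

variable {L : FirstOrder.Language.{u, v}} {M : Type w'} {C : Type w} [L.Structure M]
  [L.Structure C] {n : ℕ} {κ : Cardinal.{w}} {𝒢 : DefinableGroup L M n} {j : M ↪ₑ[L] C}
  {Δ : FormulaSet L n} [(component 𝒢 j Δ κ).Normal]

/-- The relation `E'_Δ` refines the coset equivalence relation of the component. -/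
theorem IsMonster.mk_eq_mk_of_ambitRel (hC : IsMonster L M C κ) {a b : StarPt 𝒢 j}
    (h : ambitRel 𝒢 j Δ a b) :
    (QuotientGroup.mk a : StarPt 𝒢 j ⧸ component 𝒢 j Δ κ) = QuotientGroup.mk b := by
  have := hC.compactSpace_delta (𝒢 := 𝒢) (j := j) (Δ := Δ)
  have := hC.isTopologicalGroup_quotient (𝒢 := 𝒢) (j := j) (Δ := Δ)
  have := hC.t2Space_quotient (𝒢 := 𝒢) (j := j) (Δ := Δ)
  have hcont := hC.continuous_deltaToQuotient (𝒢 := 𝒢) (j := j) (Δ := Δ)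
  let _ : MulAction (Pt 𝒢) (StarPt 𝒢 j ⧸ component 𝒢 j Δ κ) :=
    MulAction.compHom _ ((QuotientGroup.mk' (component 𝒢 j Δ κ)).comp (inclHom 𝒢 j))
  have hsmul : ∀ (g : Pt 𝒢) (y : StarPt 𝒢 j ⧸ component 𝒢 j Δ κ),
      g • y = deltaToQuotient 𝒢 j Δ κ (inclDelta 𝒢 j Δ g) * y := fun _ _ => rfl
  -- The orbit map of `y` extends to `G*` by sending `a` to its coset times `y`, and is therefore
  -- `Δ`-definable.
  have hamb : IsDeltaAmbit 𝒢 Δ (StarPt 𝒢 j ⧸ component 𝒢 j Δ κ) 1 := by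
    refine ⟨Function.Surjective.compactSpace hcont deltaToQuotient_surjective, inferInstance,
      fun g => ?_, fun y => ?_, ?_⟩
    · simp only [hsmul]
      exact continuous_const_mul _
    · exact isDeltaDefinableMap_of_extension ((continuous_mul_const y).comp hcont)
        fun g => (hsmul g y).symm
    · simp only [hsmul, mul_one]
      exact deltaToQuotient_surjective.denseRange.comp denseRange_inclDelta hcont
  exact h _ 1 hamb QuotientGroup.mk (isDeltaDefinableStarMap_iff.2 hcont) fun g =>
    ((hsmul g 1).trans (mul_one _)).symm

/-- The map `a/E'_Δ ↦ a/G*⁰⁰`. -/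
noncomputable def thetaHat (hC : IsMonster L M C κ) :
    Univ 𝒢 j Δ → StarPt 𝒢 j ⧸ component 𝒢 j Δ κ :=
  Quotient.lift QuotientGroup.mk fun _ _ h => hC.mk_eq_mk_of_ambitRel h

theorem continuous_thetaHat (hC : IsMonster L M C κ) :
    Continuous (thetaHat hC : Univ 𝒢 j Δ → StarPt 𝒢 j ⧸ component 𝒢 j Δ κ) :=
  Continuous.quotient_lift (s := ambitRel 𝒢 j Δ) continuous_quot_mk _

theorem thetaHat_smul (hC : IsMonster L M C κ) (g : Pt 𝒢) (p : Univ 𝒢 j Δ) :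
    thetaHat (κ := κ) hC (g • p) = thetaHat hC (toUniv 𝒢 j Δ (incl 𝒢 j g)) * thetaHat hC p := by
  obtain ⟨a, rfl⟩ := deltaToUniv_surjective p
  rfl

/-- Both sides are continuous in `p` and agree for `p` coming from `G`. -/
theorem thetaHat_mul (hC : IsMonster L M C κ) (p q : Univ 𝒢 j Δ) :
    thetaHat (κ := κ) hC (p * q) = thetaHat hC p * thetaHat hC q := by
  have := hC.compactSpace_star (𝒢 := 𝒢) (j := j)
  have := hC.compactSpace_delta (𝒢 := 𝒢) (j := j) (Δ := Δ)
  have := hC.isTopologicalGroup_quotient (𝒢 := 𝒢) (j := j) (Δ := Δ)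
  have := hC.t2Space_quotient (𝒢 := 𝒢) (j := j) (Δ := Δ)
  refine congrFun (denseRange_toUniv_incl.equalizer
    ((continuous_thetaHat hC).comp (continuous_mul_univ q))
    ((continuous_mul_const (thetaHat hC q)).comp (continuous_thetaHat hC)) (funext fun g => ?_)) p
  simp only [Function.comp_apply]
  rw [toUniv_incl_mul, thetaHat_smul]

theorem thetaHat_idempotent (hC : IsMonster L M C κ) {u : Univ 𝒢 j Δ} (huu : u * u = u) :
    thetaHat (κ := κ) hC u = 1 := by
  have h := thetaHat_mul (κ := κ) hC u u
  rw [huu] at h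
  exact mul_eq_left.1 h.symm

variable {I : Set (Univ 𝒢 j Δ)} {u : Univ 𝒢 j Δ}

/-- The restriction of `thetaHat` to the Ellis group is continuous for the `τ`-topology. -/
theorem continuous_thetaHat_ellis (hC : IsMonster L M C κ) (huu : u * u = u) :
    Continuous fun p : EllisGroup I u => thetaHat (κ := κ) hC p.1 := by
  have := hC.isTopologicalGroup_quotient (𝒢 := 𝒢) (j := j) (Δ := Δ)
  refine continuous_iff_isClosed.2 fun Y hY => isClosed_ellis_iff.2 ?_
  rintro x ⟨F, hF, hA, h1, h2⟩
  have h1' := ((continuous_thetaHat (κ := κ) hC).tendsto u).comp h1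
  have h2' := ((continuous_thetaHat (κ := κ) hC).tendsto x.1).comp h2
  rw [thetaHat_idempotent hC huu] at h1'
  have h3 := h1'.inv.mul h2'
  rw [inv_one, one_mul] at h3
  refine hY.mem_of_tendsto h3 (hA.mono ?_)
  rintro z ⟨a, ha, haz⟩
  simp only [Function.comp_apply]
  rw [thetaHat_smul, inv_mul_cancel_left, ← haz]
  exact ha

theorem surjective_thetaHat_ellis (hC : IsMonster L M C κ) (hI : IsMinimalLeftIdeal I)
    (hu : u ∈ I) (huu : u * u = u) :
    Function.Surjective fun p : EllisGroup I u => thetaHat (κ := κ) hC p.1 := by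
  intro y
  obtain ⟨a, rfl⟩ := QuotientGroup.mk_surjective y
  -- Multiplying by `u` on both sides moves the class of `a` into `uℳ` without changing its image,
  -- as `u` maps to `1`.
  refine ⟨⟨u * (toUniv 𝒢 j Δ a * u), _, hI.prop.2 _ _ hu, rfl⟩, ?_⟩
  simp only
  rw [thetaHat_mul, thetaHat_mul, thetaHat_idempotent hC huu, one_mul, mul_one]
  rfl

end Theta

end DeltaFlow

open DeltaFlow
theorem mainTheorem8 {L : FirstOrder.Language.{u, v}} {M : Type w'} {C : Type w}
    [L.Structure M] [L.Structure C] {n : ℕ} (𝒢 : DefinableGroup L M n) (j : M ↪ₑ[L] C)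
    (κ : Cardinal.{w}) (hC : IsMonster L M C κ)
    (Δ : FormulaSet L n) (hΔ : domFormula 𝒢 ∈ Δ)
    (I : Set (Univ 𝒢 j Δ)) (hI : IsMinimalLeftIdeal I)
    (u : Univ 𝒢 j Δ) (hu : u ∈ I) (huu : u * u = u) :
    -- the limits `p * q = lim_{g → p} g q` that define the semigroup operation exist
    (∀ p q : Univ 𝒢 j Δ,
      Filter.Tendsto (fun g : Pt 𝒢 => g • q)
        (Filter.comap (fun g : Pt 𝒢 => toUniv 𝒢 j Δ (incl 𝒢 j g)) (𝓝 p)) (𝓝 (p * q))) ∧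
    -- the component is normal, and `uℳ` is a group under the semigroup operation
    ∃ (_ : (component 𝒢 j Δ κ).Normal) (_ : Group (EllisGroup I u)),
      (∀ p q : EllisGroup I u, (p * q).1 = p.1 * q.1) ∧
      -- `θ̂(a/E'_Δ) = a/G*⁰⁰` is well defined and restricts to an epimorphism `θ` on `uℳ`
      ∃ (θhat : Univ 𝒢 j Δ → StarPt 𝒢 j ⧸ component 𝒢 j Δ κ)
        (θ : EllisGroup I u →* StarPt 𝒢 j ⧸ component 𝒢 j Δ κ),
        (∀ a : StarPt 𝒢 j, θhat (toUniv 𝒢 j Δ a) = QuotientGroup.mk a) ∧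
        (∀ p : EllisGroup I u, θ p = θhat p.1) ∧
        Function.Surjective θ ∧
        -- (1) `θ` is continuous for the `τ`-topology and the logic topology
        Continuous θ ∧
        -- (2) `H(uℳ)` is a normal subgroup contained in the kernel of `θ`
        ∃ (H : Subgroup (EllisGroup I u)) (_ : H.Normal),
          (H : Set (EllisGroup I u)) = ellisH (ellisUnit hu huu) ∧
          H ≤ θ.ker ∧
          -- (3) `p H(uℳ) ↦ θ(p)` is a well-defined continuous epimorphism
          Continuous (QuotientGroup.mk' H) ∧ Function.Surjective (QuotientGroup.mk' H) ∧
          ∃ θbar : EllisGroup I u ⧸ H →* StarPt 𝒢 j ⧸ component 𝒢 j Δ κ,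
            (∀ p : EllisGroup I u, θbar (QuotientGroup.mk p) = θ p) ∧
            Continuous θbar ∧ Function.Surjective θbar := by
  have := hC.compactSpace_star (𝒢 := 𝒢) (j := j)
  have := hC.compactSpace_delta (𝒢 := 𝒢) (j := j) (Δ := Δ)
  have hN := hC.component_normal (𝒢 := 𝒢) (j := j) (Δ := Δ)
  have := hC.t2Space_quotient (𝒢 := 𝒢) (j := j) (Δ := Δ)
  let _ : Group (EllisGroup I u) := ellisGroupStructure hI hu huu
  have hmul : ∀ p q : EllisGroup I u, (p * q).1 = p.1 * q.1 := fun _ _ => rfl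
  have hone : (1 : EllisGroup I u) = ellisUnit hu huu := rfl
  let θ : EllisGroup I u →* StarPt 𝒢 j ⧸ component 𝒢 j Δ κ :=
    MonoidHom.mk' (fun p => thetaHat hC p.1) fun p q => thetaHat_mul hC p.1 q.1
  have hθ : Continuous θ := continuous_thetaHat_ellis hC huu
  have hθs : Function.Surjective θ := surjective_thetaHat_ellis hC hI hu huu
  let H := nonseparatedSubgroup (continuous_ellis_mul_left hmul rfl)
    (continuous_ellis_mul_right hmul)
  have hH : H.Normal := nonseparatedSubgroup_normal _ _
  have hker : H ≤ θ.ker := by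
    intro x hx
    rw [MonoidHom.mem_ker]
    by_contra hne
    -- Preimages under `θ` of disjoint open sets would separate `x` from the identity.
    obtain ⟨V, W, hV, hW, hxV, h1W, hVW⟩ := t2_separation hne
    obtain ⟨y, hyV, hyW⟩ := mem_closure_iff.1
      (hx _ ((hW.preimage hθ).mem_nhds (by simpa using h1W))) _ (hV.preimage hθ) hxV
    exact Set.disjoint_left.1 hVW hyV hyW
  refine ⟨tendsto_smul_mul, hN, inferInstance, hmul, thetaHat hC, θ, fun _ => rfl, fun _ => rfl,
    hθs, hθ, H, hH, ?_, hker, continuous_quot_mk, QuotientGroup.mk'_surjective H,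
    QuotientGroup.lift H θ hker, fun _ => rfl, continuous_quot_lift _ hθ,
    fun y => let ⟨x, hx⟩ := hθs y; ⟨QuotientGroup.mk x, hx⟩⟩
  ext x
  simp only [ellisH, ← closure_ellis_eq huu, ← hone, Set.mem_iInter]
  rfl
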